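/- Let $d\ge 1$ and let $\Omega\subset\mathbb{R}^d$ be a compact set which satisfies an interior cone condition and has a Lipschitz boundary. For a finite nonempty set $X\subset\Omega$ let $h_X=\sup_{y\in\Omega}\min_{x\in X}\|y-x\|_2$ be its fill distance. Let $k:\Omega\times\Omega\to\mathbb{R}$ be a symmetric, strictly positive definite kernel that is translational invariant, i.e. $k(x,y)=\Phi(x-y)$ for some $\Phi:\mathbb{R}^d\to\mathbb{R}$, and let $\mathcal{H}$ be its native space, i.e. the Hilbert space of functions on $\Omega$ with reproducing kernel $k$. Assume that $k$ has finite smoothness $\tau>d/2$: $\mathcal{H}$ and the Sobolev space $W_2^\tau(\Omega)$ (the space of restrictions to $\Omega$ of the continuous functions in $W_2^\tau(\mathbb{R}^d)$, with the quotient norm) consist of the same functions and have equivalent norms. For a finite set $X\subset\Omega$ let $\Pi_X$ be the orthogonal projection of $\mathcal{H}$ onto $\operatorname{span}\{k(\cdot,x):x\in X\}$ and let $$P_X(x)=\sup_{0\ne g\in\mathcal{H}}\frac{|g(x)-(\Pi_X g)(x)|}{\|g\|_{\mathcal{H}}}\qquad(x\in\Omega)$$ be the Power function. For $0<\gamma\le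 1$, a $\gamma$-stabilized greedy algorithm applied to a function $f$ starts with $X_0=\emptyset$ and sets $X_{N+1}=X_N\cup\{x_{N+1}\}$, where $x_{N+1}$ is a maximizer of some given selection criterion $\eta^{(N)}:\Omega\to[0,\infty)$, which may depend on $f$, on $N$ and on the points already selected, over $$\Omega_\gamma^{(N)}=\{x\in\Omega: P_{X_N}(x)\ge\gamma\,\sup_{y\in\Omega}P_{X_N}(y)\}.$$ Then: 1. There is a constant $c>0$, depending only on $\Omega$, $k$ (and $\tau$, $d$), such that for all $0<\gamma\le 1$, all functions $f$ and all selection criteria, the points selected by any $\gamma$-stabilized greedy algorithm satisfy, for every $N\ge 1$ up to which the algorithm has been run, $$h_{X_N}\le c\,\gamma^{-2/(\tau-d/2)}\,N^{-1/d}.$$ 2. The rate $N^{-1/d}$ is optimal: there is a constant $c'>0$, depending only on $\Omega$ (and $d$), such that for every $N\ge1$, every set $X\subset\Omega$ of $N$ points satisfies $h_X\ge c'N^{-1/d}$. -/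

import Mathlib

open MeasureTheory
open scoped NNReal InnerProductSpace SchwartzMap

noncomputable section

namespace StabilizedGreedy

/-! ### Kernels and native spaces -/

/-- A strictly positive definite real kernel on `Ω`: a symmetric function all of whose kernel
matrices at pairwise distinct points are positive definite. -/
structure SPDKernel (Ω : Type*) where
  toFun : Ω → Ω → ℝ
  symm : ∀ x y, toFun x y = toFun y x
  posDef : ∀ (N : ℕ) (x : Fin N → Ω), Function.Injective x →
    (Matrix.of fun i j => toFun (x i) (x j)).PosDef

namespace SPDKernel

variable {Ω : Type*}

/-- The kernel as an operator-valued matrix, the form in which Mathlib constructs reproducing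
kernel Hilbert spaces. -/
def opMatrix (k : SPDKernel Ω) : Matrix Ω Ω (ℝ →L[ℝ] ℝ) :=
  Matrix.of fun x y => k.toFun x y • ContinuousLinearMap.id ℝ ℝ

theorem posSemidef_opMatrix (k : SPDKernel Ω) : k.opMatrix.PosSemidef := by
  have hH : k.opMatrix.IsHermitian := by
    ext x y
    have h1 : star (ContinuousLinearMap.id ℝ ℝ) = ContinuousLinearMap.id ℝ ℝ :=
      star_one (ℝ →L[ℝ] ℝ)
    simp [opMatrix, Matrix.conjTranspose_apply, k.symm x y, h1]
  have htfae := (RKHS.posSemidef_tfae (K := k.opMatrix)).out 0 2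
  refine htfae.mpr ⟨hH, fun v => ?_⟩
  let e := v.support.equivFin.symm
  have hinj : Function.Injective (fun i => ((e i : v.support) : Ω)) :=
    Subtype.val_injective.comp e.injective
  have hp := (k.posDef _ _ hinj).posSemidef.dotProduct_mulVec_nonneg (fun i => v (e i))
  have key : (v.sum fun x w => v.sum fun x' w' => ⟪k.opMatrix x' x w, w'⟫_ℝ)
      = ∑ i, v (e i) * ∑ j, k.toFun (e i) (e j) * v (e j) := by
    simp only [Finsupp.sum]
    rw [← Finset.sum_coe_sort, ← e.sum_comp]
    refine Finset.sum_congr rfl fun i _ => ?_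
    rw [← Finset.sum_coe_sort, ← e.sum_comp, Finset.mul_sum]
    refine Finset.sum_congr rfl fun j _ => ?_
    simp [opMatrix, k.symm (e i) (e j)]
    ring
  rw [key]
  simpa [dotProduct, Matrix.mulVec] using hp

instance (k : SPDKernel Ω) : Fact k.opMatrix.PosSemidef := ⟨k.posSemidef_opMatrix⟩

/-- The native space of `k`: the Hilbert space of functions on `Ω` with reproducing kernel `k`. -/
abbrev NativeSpace (k : SPDKernel Ω) : Type _ := RKHS.OfKernel k.opMatrix

/-- The kernel translate `k(·, x)` as an element of the native space. -/
def translate (k : SPDKernel Ω) (x : Ω) : k.NativeSpace := RKHS.kerFun k.NativeSpace x 1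

theorem translate_apply (k : SPDKernel Ω) (x y : Ω) : k.translate x y = k.toFun y x := by
  rw [translate, RKHS.kerFun_apply, RKHS.OfKernel.kernel_ofKernel]
  simp [opMatrix]

theorem inner_translate (k : SPDKernel Ω) (f : k.NativeSpace) (x : Ω) :
    ⟪f, k.translate x⟫_ℝ = f x := by
  simp [translate]

/-- `V(X)`, the span of the kernel translates at the points of `X`. -/
def translateSpan (k : SPDKernel Ω) (X : Finset Ω) : Submodule ℝ k.NativeSpace :=
  Submodule.span ℝ (k.translate '' (X : Set Ω))

instance (k : SPDKernel Ω) (X : Finset Ω) : FiniteDimensional ℝ (k.translateSpan X) :=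
  FiniteDimensional.span_of_finite ℝ (X.finite_toSet.image _)

/-- The interpolant of `f` on `X`: the orthogonal projection of `f` onto `V(X)`. -/
def interpolant (k : SPDKernel Ω) (X : Finset Ω) (f : k.NativeSpace) : k.NativeSpace :=
  (k.translateSpan X).starProjection f

/-- The Power function: the norm of the pointwise error functional `f ↦ f x - (Π f) x`. -/
def powerFunction (k : SPDKernel Ω) (X : Finset Ω) (x : Ω) : ℝ :=
  ⨆ f : {f : k.NativeSpace // f ≠ 0},
    |(f : k.NativeSpace) x - k.interpolant X f x| / ‖(f : k.NativeSpace)‖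

/-- The admissible set `Ω_γ`: the points where the Power function of `X` is at least `γ` times its
supremum norm. -/
def admissible (k : SPDKernel Ω) (γ : ℝ) (X : Finset Ω) : Set Ω :=
  {x | γ * (⨆ y, k.powerFunction X y) ≤ k.powerFunction X x}

end SPDKernel

/-! ### Stabilized greedy algorithms -/

/-- The set `{x 0, …, x (N - 1)}` of the first `N` points of a sequence. -/
def firstPoints {Ω : Type*} (x : ℕ → Ω) (N : ℕ) : Finset Ω :=
  open Classical in (Finset.range N).image x

/-- A selection criterion: for a target function `f`, a step `N` and the points selected before,
a nonnegative error indicator on `Ω`. -/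
abbrev SelectionCriterion (Ω : Type*) : Type _ :=
  (Ω → ℝ) → (N : ℕ) → (Fin N → Ω) → Ω → ℝ≥0

/-- `x 0, …, x (N - 1)` are selected by the first `N` steps of the `γ`-stabilized greedy algorithm
with criterion `η` applied to `f`: each point maximizes the error indicator over the admissible
set of the points before it. The terms of `x` from `x N` on are irrelevant. -/
def IsStabilizedGreedy {Ω : Type*} (k : SPDKernel Ω) (γ : ℝ) (η : SelectionCriterion Ω)
    (f : Ω → ℝ) (x : ℕ → Ω) (N : ℕ) : Prop :=
  ∀ n < N, x n ∈ k.admissible γ (firstPoints x n) ∧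
    IsMaxOn (η f n fun i => x i) (k.admissible γ (firstPoints x n)) (x n)

/-- The fill distance `sup_{y ∈ Ω} min_{x ∈ X} dist y x`. -/
def fillDistance {Ω : Type*} [PseudoMetricSpace Ω] (X : Finset Ω) : ℝ :=
  ⨆ y : Ω, Metric.infDist y (X : Set Ω)

/-! ### Conditions on the domain -/

variable {E : Type*} [NormedAddCommGroup E] [InnerProductSpace ℝ E]

/-- The closed cone with apex `x`, axis direction `ξ`, angle `θ` and radius `r`. -/
def cone (x ξ : E) (θ r : ℝ) : Set E :=
  {z | ∃ (y : E) (t : ℝ), ‖y‖ = 1 ∧ Real.cos θ ≤ ⟪y, ξ⟫_ℝ ∧ 0 ≤ t ∧ t ≤ r ∧ z = x + t • y}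

/-- The interior cone condition. -/
def InteriorConeCondition (Ω : Set E) : Prop :=
  ∃ θ r : ℝ, 0 < θ ∧ θ < Real.pi / 2 ∧ 0 < r ∧
    ∀ x ∈ Ω, ∃ ξ : E, ‖ξ‖ = 1 ∧ cone x ξ θ r ⊆ Ω

/-- A closed set has Lipschitz boundary if near each of its boundary points it is, in suitable
orthogonal coordinates, the region on and above the graph of a Lipschitz function. -/
def HasLipschitzBoundary (Ω : Set E) : Prop :=
  ∀ p ∈ frontier Ω, ∃ U ∈ nhds p, ∃ e : E, ‖e‖ = 1 ∧
    ∃ (L : ℝ≥0) (φ : (ℝ ∙ e)ᗮ → ℝ), LipschitzWith L φ ∧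
      ∀ y ∈ U, y ∈ Ω ↔ φ ((ℝ ∙ e)ᗮ.orthogonalProjectionOnto y) ≤ ⟪e, y⟫_ℝ

/-! ### Sobolev spaces and kernels of finite smoothness -/

variable [FiniteDimensional ℝ E] [MeasurableSpace E] [BorelSpace E]

/-- `g` is a continuous real function in the Sobolev space `W_2^τ` of the whole space which
restricts to `f` on `Ω`, and `u ∈ L²` is its Bessel potential of order `τ`, so that `‖u‖` is the
Sobolev norm of `g`. -/
def IsSobolevExtension (τ : ℝ) {Ω : Set E} (f : Ω → ℝ) (g : E → ℝ)
    (u : Lp ℂ 2 (volume : Measure E)) : Prop :=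
  Continuous g ∧ (∀ x : Ω, g x = f x) ∧
    ∃ G : Lp ℂ 2 (volume : Measure E), (G =ᵐ[volume] fun x => (g x : ℂ)) ∧
      TemperedDistribution.besselPotential E ℂ τ (G : 𝓢'(E, ℂ)) = (u : 𝓢'(E, ℂ))

/-- Membership in `W_2^τ(Ω)`, for `τ > d / 2`: restrictions to `Ω` of the (continuous) functions
in `W_2^τ` of the whole space. -/
def MemSobolevOn (τ : ℝ) {Ω : Set E} (f : Ω → ℝ) : Prop :=
  ∃ g u, IsSobolevExtension τ f g u

/-- The norm of `W_2^τ(Ω)`: the infimum of the Sobolev norms of the extensions. -/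
def sobolevNormOn (τ : ℝ) {Ω : Set E} (f : Ω → ℝ) : ℝ :=
  sInf {a | ∃ g u, IsSobolevExtension τ f g u ∧ a = ‖u‖}

/-- A kernel on `Ω` is of finite smoothness `τ` if its native space is norm equivalent to
`W_2^τ(Ω)`: both consist of the same functions, and their norms are equivalent. -/
def HasFiniteSmoothness {Ω : Set E} (k : SPDKernel Ω) (τ : ℝ) : Prop :=
  (∀ f : Ω → ℝ, (∃ h : k.NativeSpace, ⇑h = f) ↔ MemSobolevOn τ f) ∧
    ∃ a b : ℝ, 0 < a ∧ 0 < b ∧ ∀ h : k.NativeSpace,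
      a * sobolevNormOn τ (⇑h : Ω → ℝ) ≤ ‖h‖ ∧ ‖h‖ ≤ b * sobolevNormOn τ (⇑h : Ω → ℝ)

/-- A kernel is translational invariant if `k(x, y) = Φ(x - y)` for some function `Φ`. -/
def IsTranslationInvariant {Ω : Set E} (k : SPDKernel Ω) : Prop :=
  ∃ Φ : E → ℝ, ∀ x y : Ω, k.toFun x y = Φ (x - y)

end StabilizedGreedy

end

/-! The upper bound compares greedy residuals with widths. By duality the Power function at `y` is
the distance from `k(·, y)` to the span of the selected translates
(`powerFunction_eq_norm_residual`). Finite smoothness makes linear combinations of translates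
comparable in norm with the same combinations of Sobolev point evaluations, realized in
frequency-side `L²` as `evalVec`. Stabilized selection is therefore a weak greedy selection for
these vectors, with parameter `δ = κ γ` (`exists_isWeakGreedy`).

Three estimates then combine; put `s = τ - d / 2`. Local Taylor expansion of plane waves around a
grid approximates all evaluations up to `C 2 ^ (-s j)` from a space of dimension at most `M 2 ^ (j
d)` (`exists_widths`). A determinant argument shows that weak greedy residuals inherit this decay,
up to a factor `δ⁻²` (`exists_norm_residual_le_of_widths`). Conversely, a bump function supported in
a ball around `y` that misses the selected points shows that the residual at `y` is at least a
constant times the `s`-th power of the distance from `y` to them (`exists_infDist_rpow_le`). With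
`N` of order `2 ^ (j d)`, the distance to the power `s` is `O(γ⁻² N ^ (-s / d))`; taking `s`-th
roots gives the rate and the exponent `-2 / s` of `γ`.

The lower bound is a volume count: balls of radius `h_X` around `X` cover `Ω`, whose volume is
positive because it contains a cone. -/

noncomputable section

namespace StabilizedGreedy

/-! ### A determinant inequality for nearly low-dimensional families of vectors -/

section Determinant

variable {F : Type*} [NormedAddCommGroup F] [InnerProductSpace ℝ F]

/-- Hadamard's inequality. -/
theorem abs_det_le_prod_norm {n : ℕ} (b : OrthonormalBasis (Fin n) ℝ F) (v : Fin n → F) :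
    |b.toBasis.det v| ≤ ∏ i, ‖v i‖ := by
  have : Fact (Module.finrank ℝ F = n) := ⟨by simpa using Module.finrank_eq_card_basis b.toBasis⟩
  rw [← b.toBasis.orientation.volumeForm_robust' b v]
  exact b.toBasis.orientation.abs_volumeForm_apply_le v

theorem abs_det_eq_abs_det {n : ℕ} (b b' : OrthonormalBasis (Fin n) ℝ F) (v : Fin n → F) :
    |b.toBasis.det v| = |b'.toBasis.det v| := by
  have : Fact (Module.finrank ℝ F = n) := ⟨by simpa using Module.finrank_eq_card_basis b.toBasis⟩
  rw [← b.toBasis.orientation.volumeForm_robust' b v,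
    ← b.toBasis.orientation.volumeForm_robust' b' v]

/-- Extends an orthonormal basis of `W`, so that distance to `W` is seen only by the later
coordinates and the two groups can be rescaled separately. -/
theorem exists_orthonormalBasis_adapted {n : ℕ} (b : OrthonormalBasis (Fin n) ℝ F)
    (W : Submodule ℝ F) :
    ∃ b' : OrthonormalBasis (Fin n) ℝ F,
      ∀ i : Fin n, Module.finrank ℝ W ≤ i → ∀ w ∈ W, ⟪b' i, w⟫_ℝ = 0 := by
  have hn : Module.finrank ℝ F = n := by simpa using Module.finrank_eq_card_basis b.toBasis
  have : FiniteDimensional ℝ F := b.toBasis.finiteDimensional_of_finite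
  have hW : Module.finrank ℝ W ≤ n := hn ▸ Submodule.finrank_le W
  let c := stdOrthonormalBasis ℝ W
  let v : Fin n → F := fun i => if h : (i : ℕ) < Module.finrank ℝ W then (c ⟨i, h⟩ : F) else 0
  let s : Set (Fin n) := {i | (i : ℕ) < Module.finrank ℝ W}
  have hv : Orthonormal ℝ (s.domRestrict v) := by
    have hc : Orthonormal ℝ (fun i => (c i : F)) :=
      c.orthonormal.comp_linearIsometry W.subtypeₗᵢ
    let g : s → Fin (Module.finrank ℝ W) := fun i => ⟨i.1, i.2⟩
    have hg : Function.Injective g := by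
      intro i j hij
      apply Subtype.ext; apply Fin.ext
      simpa [g] using hij
    convert hc.comp g hg using 1
    funext i
    have hi : ((i : Fin n) : ℕ) < Module.finrank ℝ W := i.2
    simp [Set.domRestrict, v, g, hi]
  obtain ⟨b', hb'⟩ := hv.exists_orthonormalBasis_extension_of_card_eq (by simpa using hn)
  refine ⟨b', fun i hi w hw => ?_⟩
  have hrep := c.sum_repr' ⟨w, hw⟩
  have : w = ∑ j, ⟪c j, ⟨w, hw⟩⟫_ℝ • (c j : F) := by
    have := congrArg (Subtype.val) hrep
    simpa using this.symm
  rw [this, inner_sum]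
  refine Finset.sum_eq_zero fun j _ => ?_
  rw [inner_smul_right]
  let k : Fin n := ⟨j, j.2.trans_le hW⟩
  have hk : b' k = c j := by
    rw [hb' k j.2]
    simp [v, k]
  rw [← hk, b'.orthonormal.2 (i := i) (j := k), mul_zero]
  intro h
  have : (i : ℕ) = j := congrArg Fin.val h
  have := j.2
  omega

/-- The volume spanned by `2 m` vectors of norm at most `σ` which lie within `ε` of a subspace of
dimension at most `m`. -/
theorem abs_det_le_of_near_subspace {m : ℕ} (b : OrthonormalBasis (Fin (2 * m)) ℝ F)
    (W : Submodule ℝ F) (hW : Module.finrank ℝ W ≤ m) {σ ε : ℝ} (hε : 0 < ε) (hεσ : ε ≤ σ)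
    (u : Fin (2 * m) → F) (hu : ∀ i, ‖u i‖ ≤ σ) (huW : ∀ i, ∃ w ∈ W, ‖u i - w‖ ≤ ε) :
    |b.toBasis.det u| ≤ (2 * σ * ε) ^ m := by
  obtain ⟨b', hb'⟩ := exists_orthonormalBasis_adapted b W
  rw [abs_det_eq_abs_det b b']
  set m' := Module.finrank ℝ W with hm'
  have hσ : 0 < σ := hε.trans_le hεσ
  let d : Fin (2 * m) → ℝ := fun j => if (j : ℕ) < m' then σ⁻¹ else ε⁻¹
  have hd : ∀ j, 0 < d j := fun j => by dsimp only [d]; split_ifs <;> positivity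
  -- Coordinates along `W` are divided by `σ`, the others by `ε`. Each group then has norm at most
  -- `1`, and Hadamard's inequality loses only `√2 ^ (2 m) = 2 ^ m`.
  let y : Fin (2 * m) → F := fun i => ∑ j, (d j * ⟪b' j, u i⟫_ℝ) • b' j
  have hby : ∀ i j, ⟪b' j, y i⟫_ℝ = d j * ⟪b' j, u i⟫_ℝ := fun i j => by
    simp [y, b'.orthonormal.inner_right_fintype]
  have hdet : b'.toBasis.det y = (∏ j, d j) * b'.toBasis.det u := by
    have : b'.toBasis.toMatrix y = Matrix.diagonal d * b'.toBasis.toMatrix u := by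
      ext j i
      rw [Matrix.diagonal_mul, Module.Basis.toMatrix_apply, Module.Basis.toMatrix_apply,
        b'.coe_toBasis_repr_apply, b'.coe_toBasis_repr_apply, b'.repr_apply_apply,
        b'.repr_apply_apply, hby]
    rw [Module.Basis.det_apply, this, Matrix.det_mul, Matrix.det_diagonal, Module.Basis.det_apply]
  have hy : ∀ i, ‖y i‖ ≤ √2 := by
    intro i
    apply Real.le_sqrt_of_sq_le
    obtain ⟨w, hw, hwε⟩ := huW i
    rw [← b'.sum_sq_inner_right (y i)]
    have h1 : ∀ j, ⟪b' j, y i⟫_ℝ ^ 2 ≤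
        σ⁻¹ ^ 2 * ⟪b' j, u i⟫_ℝ ^ 2 + ε⁻¹ ^ 2 * ⟪b' j, u i - w⟫_ℝ ^ 2 := by
      intro j
      rw [hby, mul_pow]
      by_cases hj : (j : ℕ) < m'
      · simp only [d, hj, if_true]
        have : 0 ≤ ε⁻¹ ^ 2 * ⟪b' j, u i - w⟫_ℝ ^ 2 := by positivity
        linarith
      · simp only [d, hj, if_false, inner_sub_right, hb' j (not_lt.mp hj) w hw, sub_zero]
        have : 0 ≤ σ⁻¹ ^ 2 * ⟪b' j, u i⟫_ℝ ^ 2 := by positivity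
        linarith
    refine (Finset.sum_le_sum fun j _ => h1 j).trans ?_
    rw [Finset.sum_add_distrib, ← Finset.mul_sum, ← Finset.mul_sum, b'.sum_sq_inner_right,
      b'.sum_sq_inner_right, ← mul_pow, ← mul_pow]
    have h2 : σ⁻¹ * ‖u i‖ ≤ 1 := by
      rw [inv_mul_le_iff₀ hσ, mul_one]; exact hu i
    have h3 : ε⁻¹ * ‖u i - w‖ ≤ 1 := by
      rw [inv_mul_le_iff₀ hε, mul_one]; exact hwε
    have h4 := pow_le_one₀ (n := 2) (by positivity) h2
    have h5 := pow_le_one₀ (n := 2) (by positivity) h3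
    linarith
  -- Since `ε ≤ σ`, the product is smallest when `W` has full dimension `m`.
  have hdprod : ((σ * ε) ^ m)⁻¹ ≤ ∏ j, d j := by
    have hm2 : m' ≤ 2 * m := by omega
    have hcard : (Finset.univ.filter fun j : Fin (2 * m) => (j : ℕ) < m').card = m' := by
      rw [Fin.card_filter_val_lt]; omega
    have hcard' : (Finset.univ.filter fun j : Fin (2 * m) => ¬ (j : ℕ) < m').card = 2 * m - m' := by
      have := Finset.card_filter_add_card_filter_not (s := (Finset.univ : Finset (Fin (2 * m))))
        (fun j => (j : ℕ) < m')
      rw [hcard] at this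
      simp only [Finset.card_univ, Fintype.card_fin] at this
      omega
    simp only [d]
    rw [Finset.prod_ite, Finset.prod_const, Finset.prod_const, hcard, hcard',
      show 2 * m - m' = (m - m') + m by omega, pow_add, ← mul_assoc, ← inv_pow, mul_inv, mul_pow]
    have : σ⁻¹ ^ m = σ⁻¹ ^ m' * σ⁻¹ ^ (m - m') := by rw [← pow_add]; congr 1; omega
    rw [this]
    gcongr
  have hH := abs_det_le_prod_norm b' y
  rw [hdet, abs_mul, abs_of_pos (Finset.prod_pos fun j _ => hd j)] at hH
  have hprod : ∏ i, ‖y i‖ ≤ 2 ^ m := by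
    refine (Finset.prod_le_prod (fun i _ => norm_nonneg _) fun i _ => hy i).trans ?_
    rw [Finset.prod_const, Finset.card_univ, Fintype.card_fin, pow_mul, Real.sq_sqrt (by norm_num)]
  have hpos : 0 < (σ * ε) ^ m := by positivity
  have := (mul_le_mul_of_nonneg_right hdprod (abs_nonneg (b'.toBasis.det u))).trans
    (hH.trans hprod)
  rw [inv_mul_le_iff₀ hpos] at this
  calc _ ≤ _ := this
    _ = _ := by rw [← mul_pow]; ring

/-- The matrix `⟪g j, v i⟫` is triangular, so its determinant is at least `ρ ^ (2 m)` in absolute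
value. Its columns are also the coordinates of the `q i`, of norm at most `σ`, and lie within `ε` of
the image of `W`; the volume bound and an `m`-th root finish. -/
theorem sq_le_of_triangular {m : ℕ} (hm : 0 < m) {g v q : Fin (2 * m) → F} (hg : Orthonormal ℝ g)
    {W : Submodule ℝ F} [FiniteDimensional ℝ W] (hW : Module.finrank ℝ W ≤ m) {ρ σ ε : ℝ}
    (hρ : 0 ≤ ρ) (hε : 0 < ε)
    (htri : ∀ i j, i < j → ⟪g j, v i⟫_ℝ = 0) (hdiag : ∀ i, ρ ≤ |⟪g i, v i⟫_ℝ|)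
    (hq : ∀ i, ‖q i‖ ≤ σ) (hgq : ∀ i j, ⟪g j, v i⟫_ℝ = ⟪g j, q i⟫_ℝ)
    (hvW : ∀ i, ∃ w ∈ W, ‖v i - w‖ ≤ ε) : ρ ^ 2 ≤ 2 * σ * ε := by
  have hρσ : ρ ≤ σ := by
    let i : Fin (2 * m) := ⟨0, by omega⟩
    refine (hdiag i).trans ?_
    rw [hgq]
    refine (abs_real_inner_le_norm _ _).trans ?_
    rw [hg.1 i, one_mul]; exact hq i
  -- The volume bound needs `ε ≤ σ`; otherwise `ρ ≤ σ ≤ ε` already suffices.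
  rcases le_total σ ε with h | hεσ
  · nlinarith
  let L : F →ₗ[ℝ] EuclideanSpace ℝ (Fin (2 * m)) :=
    (WithLp.linearEquiv 2 ℝ (Fin (2 * m) → ℝ)).symm.toLinearMap ∘ₗ
      LinearMap.pi fun j => (innerₛₗ ℝ (g j))
  have hL : ∀ x j, L x j = ⟪g j, x⟫_ℝ := fun x j => by simp [L]
  have hLn : ∀ x, ‖L x‖ ≤ ‖x‖ := fun x => by
    rw [← sq_le_sq₀ (norm_nonneg _) (norm_nonneg _), EuclideanSpace.norm_sq_eq]
    simp only [hL]
    exact hg.sum_inner_products_le x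
  let b := EuclideanSpace.basisFun (Fin (2 * m)) ℝ
  have hLv : ∀ i, L (v i) = L (q i) := fun i => by ext j; rw [hL, hL, hgq]
  have hdet := abs_det_le_of_near_subspace b (W.map L) ((Submodule.finrank_map_le L W).trans hW)
    hε hεσ (fun i => L (v i)) (fun i => by rw [hLv]; exact (hLn _).trans (hq i))
    (fun i => by
      obtain ⟨w, hw, hwε⟩ := hvW i
      exact ⟨L w, Submodule.mem_map_of_mem hw, by rw [← map_sub]; exact (hLn _).trans hwε⟩)
  have hmat : b.toBasis.det (fun i => L (v i)) = ∏ i, ⟪g i, v i⟫_ℝ := by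
    rw [Module.Basis.det_apply, Matrix.det_of_isUpperTriangular]
    · refine Finset.prod_congr rfl fun i _ => ?_
      rw [Module.Basis.toMatrix_apply, b.coe_toBasis_repr_apply]
      simp [b, hL]
    · intro i j hij
      rw [Module.Basis.toMatrix_apply, b.coe_toBasis_repr_apply]
      simpa [b, hL] using htri j i hij
  rw [hmat, Finset.abs_prod] at hdet
  have hlow : ρ ^ (2 * m) ≤ ∏ i, |⟪g i, v i⟫_ℝ| := by
    have := Finset.prod_le_prod (s := Finset.univ) (f := fun _ : Fin (2 * m) => ρ)
      (fun i _ => hρ) (fun i _ => hdiag i)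
    simpa using this
  have := hlow.trans hdet
  rw [pow_mul] at this
  exact le_of_pow_le_pow_left₀ hm.ne' (by have := hρ.trans hρσ; positivity) this

end Determinant

/-! ### Greedy selection in a Hilbert space -/

section HilbertGreedy

variable {Ω F : Type*} [NormedAddCommGroup F] [InnerProductSpace ℝ F]

/-- The span of the vectors of the family `w` indexed by `X`. -/
def spanOn (w : Ω → F) (X : Finset Ω) : Submodule ℝ F :=
  Submodule.span ℝ (w '' (X : Set Ω))

instance (w : Ω → F) (X : Finset Ω) : FiniteDimensional ℝ (spanOn w X) :=
  FiniteDimensional.span_of_finite ℝ (X.finite_toSet.image _)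

/-- The component of `w y` orthogonal to the vectors indexed by `X`. -/
def residual (w : Ω → F) (X : Finset Ω) (y : Ω) : F :=
  w y - (spanOn w X).starProjection (w y)

theorem mem_spanOn (w : Ω → F) {X : Finset Ω} {x : Ω} (hx : x ∈ X) : w x ∈ spanOn w X :=
  Submodule.subset_span ⟨x, hx, rfl⟩

theorem spanOn_mono (w : Ω → F) {X Y : Finset Ω} (h : X ⊆ Y) : spanOn w X ≤ spanOn w Y :=
  Submodule.span_mono (Set.image_mono (by exact_mod_cast h))

theorem norm_residual_le (w : Ω → F) (X : Finset Ω) (y : Ω) {z : F} (hz : z ∈ spanOn w X) :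
    ‖residual w X y‖ ≤ ‖w y - z‖ := by
  rw [residual, Submodule.starProjection_minimal]
  exact ciInf_le ⟨0, by rintro _ ⟨a, rfl⟩; exact norm_nonneg _⟩ (⟨z, hz⟩ : spanOn w X)

theorem norm_residual_le_norm (w : Ω → F) (X : Finset Ω) (y : Ω) : ‖residual w X y‖ ≤ ‖w y‖ := by
  simpa using norm_residual_le w X y (zero_mem _)

theorem norm_residual_anti (w : Ω → F) {X Y : Finset Ω} (h : X ⊆ Y) (y : Ω) :
    ‖residual w Y y‖ ≤ ‖residual w X y‖ :=
  norm_residual_le w Y y (spanOn_mono w h (Submodule.starProjection_apply_mem _ _))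

theorem inner_residual (w : Ω → F) (X : Finset Ω) (y : Ω) {z : F} (hz : z ∈ spanOn w X) :
    ⟪residual w X y, z⟫_ℝ = 0 :=
  Submodule.starProjection_inner_eq_zero _ z hz

theorem firstPoints_mono (x : ℕ → Ω) {m n : ℕ} (h : m ≤ n) : firstPoints x m ⊆ firstPoints x n :=
  open Classical in Finset.image_subset_image (Finset.range_mono h)

theorem mem_firstPoints (x : ℕ → Ω) {m n : ℕ} (h : m < n) : x m ∈ firstPoints x n :=
  open Classical in Finset.mem_image_of_mem x (Finset.mem_range.mpr h)

/-- The first `N` terms of `x` are a weak greedy selection with parameter `δ` for the family `w`: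
the residual of each of them is at least `δ` times the residual of any point. -/
def IsWeakGreedy (w : Ω → F) (δ : ℝ) (x : ℕ → Ω) (N : ℕ) : Prop :=
  ∀ n < N, ∀ y, δ * ‖residual w (firstPoints x n) y‖ ≤ ‖residual w (firstPoints x n) (x n)‖

/-- The Gram–Schmidt directions of the points selected in steps `K, …, K + 2 m - 1` make the pairing
with `w` triangular, with the selected residuals on the diagonal. Residuals only decrease, so the
greedy property bounds each of these below by `ρ`. All the directions are orthogonal to the first
`K` vectors, so `w` may be replaced by its residual after `K` steps, of norm at most `A`. -/
theorem IsWeakGreedy.sq_le {w : Ω → F} {δ : ℝ} {x : ℕ → Ω} {N : ℕ} (h : IsWeakGreedy w δ x N)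
    (hδ : 0 < δ) {m K : ℕ} (hm : 0 < m) (hK : K + 2 * m ≤ N) {A ε : ℝ} (hε : 0 < ε)
    (hA : ∀ y, ‖residual w (firstPoints x K) y‖ ≤ A)
    {W : Submodule ℝ F} [FiniteDimensional ℝ W] (hW : Module.finrank ℝ W ≤ m)
    (hwW : ∀ y, ∃ z ∈ W, ‖w y - z‖ ≤ ε) (y : Ω) :
    (δ * ‖residual w (firstPoints x (K + 2 * m)) y‖) ^ 2 ≤ 2 * A * ε := by
  set ρ := δ * ‖residual w (firstPoints x (K + 2 * m)) y‖ with hρ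
  have hA0 : 0 ≤ A := (norm_nonneg _).trans (hA y)
  have hρ0 : 0 ≤ ρ := by positivity
  rcases hρ0.eq_or_lt with h0 | hρpos
  · rw [← h0, zero_pow two_ne_zero]; positivity
  let e : ℕ → F := fun n => residual w (firstPoints x n) (x n)
  have he : ∀ n < K + 2 * m, ρ ≤ ‖e n‖ := fun n hn => by
    refine le_trans ?_ (h n (by omega) y)
    rw [hρ]
    gcongr
    exact norm_residual_anti w (firstPoints_mono x hn.le) y
  have hmem : ∀ {n n'}, n < n' → e n ∈ spanOn w (firstPoints x n') := fun {n n'} hn =>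
    Submodule.sub_mem _ (mem_spanOn w (mem_firstPoints x hn))
      (spanOn_mono w (firstPoints_mono x hn.le) (Submodule.starProjection_apply_mem _ _))
  have horth : ∀ {n n'}, n < n' → ⟪e n', e n⟫_ℝ = 0 := fun hn => inner_residual w _ _ (hmem hn)
  let g : Fin (2 * m) → F := fun i => ‖e (K + i)‖⁻¹ • e (K + i)
  have hepos : ∀ i : Fin (2 * m), 0 < ‖e (K + i)‖ := fun i =>
    hρpos.trans_le (he _ (by have := i.2; omega))
  have hg : Orthonormal ℝ g := by
    refine ⟨fun i => ?_, fun i j hij => ?_⟩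
    · simp only [g, norm_smul, norm_inv, norm_norm]
      exact inv_mul_cancel₀ (hepos i).ne'
    · simp only [g, inner_smul_left, inner_smul_right]
      have hij' : (i : ℕ) ≠ j := fun h => hij (Fin.ext h)
      rcases lt_or_gt_of_ne hij' with hlt | hlt
      · rw [real_inner_comm, horth (by omega)]; simp
      · rw [horth (by omega)]; simp
  refine sq_le_of_triangular (g := g) (v := fun i => w (x (K + i)))
    (q := fun i => residual w (firstPoints x K) (x (K + i))) hm hg hW hρ0 hε ?_ ?_
    (fun i => hA _) ?_ (fun i => hwW _)
  · intro i j hij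
    have hij' : (i : ℕ) < j := hij
    simp only [g, inner_smul_left]
    rw [inner_residual w _ _ (mem_spanOn w (mem_firstPoints x (by omega))), mul_zero]
  · intro i
    have h1 : ⟪e (K + i), w (x (K + i))⟫_ℝ = ‖e (K + i)‖ ^ 2 := by
      have : w (x (K + i)) = e (K + i) +
          (spanOn w (firstPoints x (K + i))).starProjection (w (x (K + i))) := by
        simp [e, residual]
      conv_lhs => rw [this]
      rw [inner_add_right, inner_residual w _ _ (Submodule.starProjection_apply_mem _ _), add_zero,
        real_inner_self_eq_norm_sq]
    simp only [g, inner_smul_left, h1, RCLike.conj_to_real]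
    rw [pow_two, inv_mul_cancel_left₀ (hepos i).ne', abs_norm]
    exact he _ (by have := i.2; omega)
  · intro i j
    simp only [g, inner_smul_left]
    congr 1
    rw [residual, inner_sub_right, inner_residual w _ _ (spanOn_mono w
      (firstPoints_mono x (by omega)) (Submodule.starProjection_apply_mem _ _)), sub_zero]

/-- Weak greedy selections realize the polynomial decay of the widths of a family of vectors. -/
theorem exists_norm_residual_le_of_widths (w : Ω → F) {B C β : ℝ} (hβ : 0 < β)
    (hC : 0 < C) (hB : ∀ y, ‖w y‖ ≤ B) {M d : ℕ} (hM : 0 < M) (hd : 1 ≤ d)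
    (hwidth : ∀ j : ℕ, ∃ W : Submodule ℝ F, FiniteDimensional ℝ W ∧
      Module.finrank ℝ W ≤ M * 2 ^ (j * d) ∧ ∀ y, ∃ z ∈ W, ‖w y - z‖ ≤ C * β ^ j) :
    ∃ C' : ℝ, 0 < C' ∧ ∀ δ : ℝ, 0 < δ → δ ≤ 1 → ∀ (x : ℕ → Ω) (N : ℕ), IsWeakGreedy w δ x N →
      ∀ j : ℕ, 2 * (M * 2 ^ (j * d)) ≤ N →
        ∀ y, ‖residual w (firstPoints x (2 * (M * 2 ^ (j * d)))) y‖ ≤ C' / δ ^ 2 * β ^ j := by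
  -- `B` starts the induction; the second term gives `2 C ≤ C' β ^ 2`, which closes it. The power
  -- `δ⁻²` reproduces itself: a step turns it into the square root of `δ⁻² · δ⁻²`.
  set C' := max B (2 * C / β ^ 2) with hC'
  have hC'pos : 0 < C' := lt_max_of_lt_right (by positivity)
  refine ⟨C', hC'pos, fun δ hδ hδ1 x N hg j => ?_⟩
  induction j with
  | zero =>
    intro _ y
    have hBC : B ≤ C' := le_max_left _ _
    refine (norm_residual_le_norm w _ y).trans ((hB y).trans (hBC.trans ?_))
    rw [pow_zero, mul_one, le_div_iff₀ (by positivity)]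
    exact mul_le_of_le_one_right hC'pos.le (pow_le_one₀ hδ.le hδ1)
  | succ j ih =>
    intro hN y
    set m := M * 2 ^ (j * d) with hm
    have hmpos : 0 < m := by positivity
    -- Passing to the next level at least doubles the number of points, which leaves room for the `2
    -- m` steps of the determinant argument.
    have hle : 2 * m + 2 * m ≤ 2 * (M * 2 ^ ((j + 1) * d)) := by
      have : 2 ^ 1 ≤ 2 ^ d := Nat.pow_le_pow_right (by norm_num) hd
      have h2 : M * 2 ^ ((j + 1) * d) = m * 2 ^ d := by rw [hm, add_mul, one_mul, pow_add, mul_assoc]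
      rw [h2]
      nlinarith
    obtain ⟨W, hWf, hWd, hW⟩ := hwidth j
    have hstep := hg.sq_le hδ hmpos (K := 2 * m) (hle.trans hN) (ε := C * β ^ j) (by positivity)
      (ih (by omega)) hWd hW y
    refine (norm_residual_anti w (firstPoints_mono x hle) y).trans ?_
    rw [← sq_le_sq₀ (norm_nonneg _) (by positivity)]
    rw [mul_pow, ← le_div_iff₀' (by positivity)] at hstep
    refine hstep.trans ?_
    have h2C : 2 * C ≤ C' * β ^ 2 := by
      rw [← div_le_iff₀ (by positivity)]; exact le_max_right _ _
    calc 2 * (C' / δ ^ 2 * β ^ j) * (C * β ^ j) / δ ^ 2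
        = (2 * C) * (C' * (β ^ j) ^ 2 / δ ^ 4) := by field_simp
      _ ≤ (C' * β ^ 2) * (C' * (β ^ j) ^ 2 / δ ^ 4) := by gcongr
      _ = (C' / δ ^ 2 * β ^ (j + 1)) ^ 2 := by rw [pow_succ β j]; field_simp

/-- If linear combinations of `k` are dominated by those of `w`, so are the residuals. -/
theorem norm_residual_le_of_linearCombination {H : Type*} [NormedAddCommGroup H]
    [InnerProductSpace ℝ H] (k : Ω → H) (w : Ω → F) {B : ℝ}
    (hB : ∀ c : Ω →₀ ℝ, ‖Finsupp.linearCombination ℝ k c‖ ≤ B * ‖Finsupp.linearCombination ℝ w c‖)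
    (X : Finset Ω) (y : Ω) : ‖residual k X y‖ ≤ B * ‖residual w X y‖ := by
  have hmem : (spanOn w X).starProjection (w y) ∈ spanOn w X :=
    Submodule.starProjection_apply_mem _ _
  obtain ⟨l, hl, hlw⟩ := (Finsupp.mem_span_image_iff_linearCombination ℝ).mp hmem
  have hk : Finsupp.linearCombination ℝ k l ∈ spanOn k X :=
    (Finsupp.mem_span_image_iff_linearCombination ℝ).mpr ⟨l, hl, rfl⟩
  have := hB (Finsupp.single y 1 - l)
  rw [map_sub, map_sub, hlw, Finsupp.linearCombination_single, Finsupp.linearCombination_single,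
    one_smul, one_smul] at this
  exact (norm_residual_le k X y hk).trans this

/-- A functional vanishing on the span sees only the residual of `w y`; Cauchy–Schwarz does the
rest. This turns test functions into lower bounds for residuals. -/
theorem one_le_norm_residual_mul (w : Ω → F) (X : Finset Ω) (y : Ω) {u : F}
    (hX : ∀ x ∈ X, ⟪u, w x⟫_ℝ = 0) (hy : ⟪u, w y⟫_ℝ = 1) : 1 ≤ ‖residual w X y‖ * ‖u‖ := by
  have h0 : ∀ z ∈ spanOn w X, ⟪u, z⟫_ℝ = 0 := by
    intro z hz
    have : spanOn w X ≤ LinearMap.ker (innerₛₗ ℝ u) := by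
      rw [spanOn, Submodule.span_le]
      rintro _ ⟨x, hx, rfl⟩
      simpa using hX x hx
    simpa using this hz
  have h1 : ⟪u, residual w X y⟫_ℝ = 1 := by
    rw [residual, inner_sub_right, hy, h0 _ (Submodule.starProjection_apply_mem _ _), sub_zero]
  calc 1 = ⟪u, residual w X y⟫_ℝ := h1.symm
    _ ≤ ‖u‖ * ‖residual w X y‖ := real_inner_le_norm _ _
    _ = _ := mul_comm _ _

end HilbertGreedy

/-! ### The Power function as a residual -/

/-- By self-adjointness of the projection, the residual of `k(·, y)` is the Riesz representer of the
error functional at `y`; the supremum is attained at it. -/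
theorem powerFunction_eq_norm_residual {Ω : Type*} (k : SPDKernel Ω) (X : Finset Ω) (y : Ω) :
    k.powerFunction X y = ‖residual k.translate X y‖ := by
  set r := residual k.translate X y with hr
  have herr : ∀ f : k.NativeSpace, f y - k.interpolant X f y = ⟪f, r⟫_ℝ := by
    intro f
    rw [← k.inner_translate f y, ← k.inner_translate (k.interpolant X f) y, hr, residual,
      inner_sub_right, SPDKernel.interpolant, Submodule.inner_starProjection_left_eq_right]
    rfl
  have hle : ∀ f : {f : k.NativeSpace // f ≠ 0},
      |(f : k.NativeSpace) y - k.interpolant X f y| / ‖(f : k.NativeSpace)‖ ≤ ‖r‖ := by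
    intro f
    rw [herr, div_le_iff₀ (norm_pos_iff.mpr f.2), mul_comm]
    exact abs_real_inner_le_norm _ _
  refine le_antisymm (Real.iSup_le hle (norm_nonneg _)) ?_
  by_cases h0 : r = 0
  · rw [h0, norm_zero]
    exact Real.iSup_nonneg fun f => by positivity
  · refine le_trans (le_of_eq ?_) (le_ciSup ⟨‖r‖, by rintro _ ⟨f, rfl⟩; exact hle f⟩ ⟨r, h0⟩)
    rw [herr, real_inner_self_eq_norm_sq, abs_of_nonneg (by positivity), pow_two,
      mul_div_assoc, div_self (norm_ne_zero_iff.mpr h0), mul_one]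

/-! ### Point evaluations on Sobolev spaces, on the Fourier side -/

/-- The symbol `(1 + |ξ|²) ^ (-τ / 2)` of the inverse Bessel potential. -/
def besselSymbol {E : Type*} [NormedAddCommGroup E] (τ : ℝ) (ξ : E) : ℝ := (1 + ‖ξ‖ ^ 2) ^ (-τ / 2)

theorem besselSymbol_pos {E : Type*} [NormedAddCommGroup E] (τ : ℝ) (ξ : E) :
    0 < besselSymbol τ ξ := by
  unfold besselSymbol; positivity

theorem besselSymbol_sq {E : Type*} [NormedAddCommGroup E] (τ : ℝ) (ξ : E) :
    besselSymbol τ ξ ^ 2 = (1 + ‖ξ‖ ^ 2) ^ (-τ) := by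
  rw [besselSymbol, ← Real.rpow_mul_natCast (by positivity)]
  congr 1; push_cast; ring

theorem continuous_besselSymbol {E : Type*} [NormedAddCommGroup E] (τ : ℝ) :
    Continuous (besselSymbol τ : E → ℝ) := by
  unfold besselSymbol
  refine Continuous.rpow_const (by fun_prop) fun ξ => Or.inl (by positivity)

theorem order_nonneg {n : ℕ} {τ : ℝ} (hτ : (n : ℝ) < 2 * τ) : 0 ≤ τ := by
  have : (0 : ℝ) ≤ n := by positivity
  linarith

/-- The Fourier representative of the evaluation at `x` on the Sobolev space of order `τ`. -/
def evalFun {E : Type*} [NormedAddCommGroup E] [InnerProductSpace ℝ E] (τ : ℝ) (x : E) (ξ : E) : ℂ :=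
  besselSymbol τ ξ * Complex.exp ((-(2 * Real.pi * ⟪ξ, x⟫_ℝ) : ℝ) * Complex.I)

theorem norm_evalFun {E : Type*} [NormedAddCommGroup E] [InnerProductSpace ℝ E]
    (τ : ℝ) (x ξ : E) : ‖evalFun τ x ξ‖ = besselSymbol τ ξ := by
  rw [evalFun, norm_mul, Complex.norm_exp_ofReal_mul_I, mul_one, Complex.norm_real,
    Real.norm_of_nonneg (besselSymbol_pos τ ξ).le]

theorem continuous_evalFun {E : Type*} [NormedAddCommGroup E] [InnerProductSpace ℝ E]
    (τ : ℝ) (x : E) : Continuous (evalFun τ x) := by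
  unfold evalFun
  refine (Complex.continuous_ofReal.comp (continuous_besselSymbol τ)).mul ?_
  fun_prop

section Fourier

open FourierTransform TemperedDistribution
open scoped ENNReal ContDiff

variable {E : Type*} [NormedAddCommGroup E] [InnerProductSpace ℝ E] [FiniteDimensional ℝ E]
  [MeasurableSpace E] [BorelSpace E]

theorem fourierInv_toSchwartz_flip (φ : 𝓢(E, ℂ)) {f : E → ℂ} (hf : Integrable f) :
    ∫ ξ, 𝓕⁻ φ ξ • f ξ = ∫ x, φ x • 𝓕⁻ f x := by
  have h := VectorFourier.integral_fourierIntegral_smul_eq_flip (L := -innerₗ E) (μ := volume)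
    (ν := volume) (f := φ) (g := f) Real.continuous_fourierChar
    (by simpa using! continuous_inner.neg) φ.integrable hf
  have hflip : (-innerₗ E).flip = -innerₗ E := by
    ext x y; simp [real_inner_comm]
  rw [hflip] at h
  rw [SchwartzMap.fourierInv_coe]
  exact h

theorem continuous_fourierInv_of_integrable {f : E → ℂ} (hf : Integrable f) :
    Continuous (𝓕⁻ f) :=
  VectorFourier.fourierIntegral_continuous (L := -innerₗ E) Real.continuous_fourierChar
    (by simpa using! continuous_inner.neg) hf

/-- On `L¹ ∩ L²`, the inverse Fourier transforms of `L¹` and `L²` agree. -/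
theorem coeFn_fourierInv_of_integrable (f : Lp ℂ 2 (volume : Measure E)) (hf : Integrable f) :
    ⇑(𝓕⁻ f : Lp ℂ 2 (volume : Measure E)) =ᵐ[volume] 𝓕⁻ (f : E → ℂ) := by
  refine ae_eq_of_integral_contDiff_smul_eq ((Lp.memLp _).locallyIntegrable (by norm_num))
    (continuous_fourierInv_of_integrable hf).locallyIntegrable fun g g_smooth g_cpt => ?_
  have hg₁ : HasCompactSupport (Complex.ofRealCLM ∘ g) := g_cpt.comp_left rfl
  have hg₂ : ContDiff ℝ ∞ (Complex.ofRealCLM ∘ g) := by fun_prop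
  let φ : 𝓢(E, ℂ) := hg₁.toSchwartzMap hg₂
  have hφ : ∀ (h : E → ℂ), ∫ x, g x • h x = ∫ x, φ x • h x := fun h => by simp [φ]
  -- Both transforms are moved onto the test function: by Fubini for `L¹`, by the definition on
  -- tempered distributions for `L²`.
  rw [hφ, hφ, ← fourierInv_toSchwartz_flip φ hf, ← Lp.toTemperedDistribution_apply,
    ← Lp.fourierInv_toTemperedDistribution_eq, fourierInv_apply, Lp.toTemperedDistribution_apply]

theorem memLp_besselSymbol {τ : ℝ} (hτ : (Module.finrank ℝ E : ℝ) < 2 * τ) :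
    MemLp (fun ξ : E => (besselSymbol τ ξ : ℂ)) 2 := by
  have : MemLp (fun ξ : E => besselSymbol τ ξ) 2 := by
    rw [memLp_two_iff_integrable_sq (continuous_besselSymbol τ).aestronglyMeasurable]
    refine (integrable_rpow_neg_one_add_norm_sq hτ).congr (ae_of_all _ fun ξ => ?_)
    simp only [besselSymbol_sq]
    congr 1
    ring
  exact this.ofReal

theorem memLp_top_besselSymbol {τ : ℝ} (hτ : 0 ≤ τ) :
    MemLp (fun ξ : E => (besselSymbol τ ξ : ℂ)) ⊤ := by
  refine memLp_top_of_bound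
    (Complex.continuous_ofReal.comp (continuous_besselSymbol τ)).aestronglyMeasurable 1
    (ae_of_all _ fun ξ => ?_)
  rw [Complex.norm_real, Real.norm_of_nonneg (besselSymbol_pos τ ξ).le]
  exact Real.rpow_le_one_of_one_le_of_nonpos (by nlinarith [sq_nonneg ‖ξ‖]) (by linarith)

theorem memLp_evalFun {τ : ℝ} (hτ : (Module.finrank ℝ E : ℝ) < 2 * τ) (x : E) :
    MemLp (evalFun τ x) 2 :=
  (memLp_besselSymbol hτ).congr_norm (continuous_evalFun τ x).aestronglyMeasurable
    (ae_of_all _ fun ξ => by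
      rw [norm_evalFun, Complex.norm_real, Real.norm_of_nonneg (besselSymbol_pos τ ξ).le])

/-- The evaluation at `x`, represented in `L²` of the frequency space. -/
def evalVec {τ : ℝ} (hτ : (Module.finrank ℝ E : ℝ) < 2 * τ) (x : E) :
    Lp ℂ 2 (volume : Measure E) :=
  (memLp_evalFun hτ x).toLp

theorem integrable_besselSymbol_mul {τ : ℝ} (hτ : (Module.finrank ℝ E : ℝ) < 2 * τ)
    (v : Lp ℂ 2 (volume : Measure E)) :
    Integrable fun ξ => (besselSymbol τ ξ : ℂ) * v ξ :=
  (memLp_besselSymbol hτ).integrable_mul (Lp.memLp v)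

theorem inner_evalVec {τ : ℝ} (hτ : (Module.finrank ℝ E : ℝ) < 2 * τ)
    (x : E) (v : Lp ℂ 2 (volume : Measure E)) :
    ⟪evalVec hτ x, v⟫_ℝ = (𝓕⁻ (fun ξ => (besselSymbol τ ξ : ℂ) * v ξ) x).re := by
  have hint : Integrable fun ξ => Complex.exp (↑(2 * Real.pi * ⟪ξ, x⟫_ℝ) * Complex.I) •
      ((besselSymbol τ ξ : ℂ) * v ξ) := by
    refine (integrable_besselSymbol_mul hτ v).congr' ?_ (ae_of_all _ fun ξ => ?_)
    · have hc : Continuous fun ξ : E => Complex.exp (↑(2 * Real.pi * ⟪ξ, x⟫_ℝ) * Complex.I) := by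
        fun_prop
      exact hc.aestronglyMeasurable.mul (integrable_besselSymbol_mul hτ v).1
    · rw [norm_smul, Complex.norm_exp_ofReal_mul_I, one_mul]
  rw [L2.inner_def, Real.fourierInv_eq']
  have := integral_re hint
  simp only [RCLike.re_to_complex] at this
  rw [← this]
  refine integral_congr_ae ?_
  filter_upwards [(memLp_evalFun hτ x).coeFn_toLp] with ξ hξ
  rw [evalVec, hξ, Complex.inner, evalFun]
  congr 1
  rw [map_mul, Complex.conj_ofReal, ← Complex.exp_conj, map_mul, Complex.conj_I,
    Complex.conj_ofReal, smul_eq_mul]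
  push_cast
  ring_nf

/-- Multiplication by the symbol of the inverse Bessel potential. -/
def besselMul {τ : ℝ} (hτ : (Module.finrank ℝ E : ℝ) < 2 * τ) (v : Lp ℂ 2 (volume : Measure E)) :
    Lp ℂ 2 (volume : Measure E) :=
  (memLp_top_besselSymbol (E := E) (order_nonneg hτ)).toLp • v

theorem toTemperedDistribution_injective :
    Function.Injective (Lp.toTemperedDistribution : Lp ℂ 2 (volume : Measure E) → 𝓢'(E, ℂ)) := by
  have := Lp.ker_toTemperedDistributionCLM_eq_bot (F := ℂ) (μ := (volume : Measure E)) (p := 2)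
  exact LinearMap.ker_eq_bot.mp this

/-- Functions whose Bessel potential is in `L²`, on the Fourier side. -/
theorem besselPotential_eq_iff {τ : ℝ} (hτ : (Module.finrank ℝ E : ℝ) < 2 * τ)
    (G u : Lp ℂ 2 (volume : Measure E)) :
    besselPotential E ℂ τ (G : 𝓢'(E, ℂ)) = (u : 𝓢'(E, ℂ)) ↔
      𝓕 G = besselMul hτ (𝓕 u) := by
  rw [← besselPotential_neg_apply_eq_iff, ← toTemperedDistribution_injective.eq_iff, besselMul,
    Lp.toTemperedDistribution_smul_eq (by unfold besselSymbol; fun_prop),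
    ← Lp.fourier_toTemperedDistribution_eq, ← Lp.fourier_toTemperedDistribution_eq]
  have h : smulLeftCLM ℂ (fun ξ : E => (besselSymbol τ ξ : ℂ)) (𝓕 (u : 𝓢'(E, ℂ))) =
      𝓕 (besselPotential E ℂ (-τ) (u : 𝓢'(E, ℂ))) := by
    rw [fourier_besselPotential_eq_smulLeftCLM_fourier_apply]
    rfl
  rw [h]
  constructor
  · intro h; rw [h]
  · intro h
    have := congrArg (fun T : 𝓢'(E, ℂ) => 𝓕⁻ T) h
    simp only [fourierInv_fourier_eq] at this
    exact this.symm

theorem coeFn_besselSymbol_smul {τ : ℝ} (hτ : (Module.finrank ℝ E : ℝ) < 2 * τ)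
    (v : Lp ℂ 2 (volume : Measure E)) :
    ⇑(besselMul hτ v) =ᵐ[volume]
      fun ξ => (besselSymbol τ ξ : ℂ) * v ξ := by
  filter_upwards [Lp.coeFn_lpSMul (r := 2)
    (memLp_top_besselSymbol (E := E) (order_nonneg hτ)).toLp v,
    (memLp_top_besselSymbol (E := E) (order_nonneg hτ)).coeFn_toLp] with ξ h1 h2
  rw [besselMul, h1, Pi.smul_apply', h2, smul_eq_mul]

theorem coeFn_fourierInv_besselSymbol_smul {τ : ℝ}
    (hτ : (Module.finrank ℝ E : ℝ) < 2 * τ) (v : Lp ℂ 2 (volume : Measure E)) :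
    ⇑(𝓕⁻ (besselMul hτ v) : Lp ℂ 2 (volume : Measure E)) =ᵐ[volume]
      𝓕⁻ fun ξ => (besselSymbol τ ξ : ℂ) * v ξ := by
  have h := coeFn_besselSymbol_smul hτ v
  refine (coeFn_fourierInv_of_integrable _
    ((integrable_besselSymbol_mul hτ v).congr h.symm)).trans (ae_of_all _ fun x => ?_)
  exact Real.fourierInv_congr_ae h x

/-- The symbol times `𝓕 u` is a product of two `L²` functions, hence integrable with continuous
inverse transform. It agrees with `g` almost everywhere, so everywhere by continuity. -/
theorem IsSobolevExtension.apply_eq {τ : ℝ} (hτ : (Module.finrank ℝ E : ℝ) < 2 * τ)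
    {Ω : Set E} {f : Ω → ℝ} {g : E → ℝ}
    {u : Lp ℂ 2 (volume : Measure E)} (h : IsSobolevExtension τ f g u) (x : E) :
    g x = ⟪evalVec hτ x, 𝓕 u⟫_ℝ := by
  obtain ⟨hg, -, G, hG, hu⟩ := h
  rw [besselPotential_eq_iff hτ] at hu
  have h1 : (fun x => (g x : ℂ)) =ᵐ[volume] 𝓕⁻ fun ξ => (besselSymbol τ ξ : ℂ) * (𝓕 u) ξ := by
    refine hG.symm.trans ?_
    have := coeFn_fourierInv_besselSymbol_smul hτ (𝓕 u)
    rwa [← hu, fourierInv_fourier_eq] at this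
  have h2 := (Continuous.ae_eq_iff_eq volume (by fun_prop)
    (continuous_fourierInv_of_integrable (integrable_besselSymbol_mul hτ (𝓕 u)))).mp h1
  rw [inner_evalVec, ← h2, Complex.ofReal_re]

/-- The real inner product sees only the real part of the inverse transform. Pairing with `-i v`
yields its imaginary part, so `hv` says that the function represented by `v` is real-valued. -/
theorem isSobolevExtension_of_real {τ : ℝ} (hτ : (Module.finrank ℝ E : ℝ) < 2 * τ)
    {Ω : Set E} (v : Lp ℂ 2 (volume : Measure E))
    (hv : ∀ x, ⟪evalVec hτ x, (-Complex.I) • v⟫_ℝ = 0) :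
    IsSobolevExtension τ (fun x : Ω => ⟪evalVec hτ (x : E), v⟫_ℝ)
      (fun x => ⟪evalVec hτ x, v⟫_ℝ) (𝓕⁻ v) := by
  have him : ∀ x, (𝓕⁻ (fun ξ => (besselSymbol τ ξ : ℂ) * v ξ) x).im = 0 := by
    intro x
    have h := hv x
    rw [inner_evalVec] at h
    rw [← h]
    have : 𝓕⁻ (fun ξ => (besselSymbol τ ξ : ℂ) * ((-Complex.I) • v : Lp ℂ 2 volume) ξ) x
        = (-Complex.I) * 𝓕⁻ (fun ξ => (besselSymbol τ ξ : ℂ) * v ξ) x := by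
      rw [Real.fourierInv_eq, Real.fourierInv_eq, ← integral_const_mul]
      refine integral_congr_ae ?_
      filter_upwards [Lp.coeFn_smul (-Complex.I) v] with ξ hξ
      rw [hξ, Pi.smul_apply, Circle.smul_def, Circle.smul_def]
      simp only [smul_eq_mul]
      ring
    rw [this]
    simp
  have hre : ∀ x, ((⟪evalVec hτ x, v⟫_ℝ : ℝ) : ℂ)
      = 𝓕⁻ (fun ξ => (besselSymbol τ ξ : ℂ) * v ξ) x := fun x => by
    rw [inner_evalVec]
    apply Complex.ext
    · simp
    · rw [him, Complex.ofReal_im]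
  refine ⟨?_, fun _ => rfl,
    𝓕⁻ (besselMul hτ v), ?_, ?_⟩
  · simp only [inner_evalVec]
    exact Complex.continuous_re.comp
      (continuous_fourierInv_of_integrable (integrable_besselSymbol_mul hτ v))
  · simp only [hre]
    exact coeFn_fourierInv_besselSymbol_smul hτ v
  · rw [besselPotential_eq_iff hτ, fourier_fourierInv_eq, fourier_fourierInv_eq]

/-- The symbol is even and the remaining sine is odd in `ξ`, so the integral vanishes: real
combinations of evaluations represent real functions. -/
theorem inner_evalVec_smul_evalVec {τ : ℝ} (hτ : (Module.finrank ℝ E : ℝ) < 2 * τ)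
    (x y : E) :
    ⟪evalVec hτ x, (-Complex.I) • evalVec hτ y⟫_ℝ = 0 := by
  rw [L2.inner_def]
  have h : ∀ᵐ ξ : E, ⟪evalVec hτ x ξ, ((-Complex.I) • evalVec hτ y : Lp ℂ 2 volume) ξ⟫_ℝ =
      besselSymbol τ ξ ^ 2 * Real.sin (2 * Real.pi * (⟪ξ, x⟫_ℝ - ⟪ξ, y⟫_ℝ)) := by
    filter_upwards [(memLp_evalFun hτ x).coeFn_toLp, (memLp_evalFun hτ y).coeFn_toLp,
      Lp.coeFn_smul (-Complex.I) (evalVec hτ y)] with ξ h1 h2 h3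
    rw [h3, Pi.smul_apply, evalVec, evalVec, h1, h2, Complex.inner, evalFun, evalFun]
    rw [mul_comm]
    have : (starRingEnd ℂ) (↑(besselSymbol τ ξ) *
          Complex.exp (↑(-(2 * Real.pi * ⟪ξ, x⟫_ℝ)) * Complex.I)) *
        -Complex.I • (↑(besselSymbol τ ξ) *
          Complex.exp (↑(-(2 * Real.pi * ⟪ξ, y⟫_ℝ)) * Complex.I)) =
        ((besselSymbol τ ξ ^ 2 : ℝ) : ℂ) * (-Complex.I *
          Complex.exp (↑(2 * Real.pi * (⟪ξ, x⟫_ℝ - ⟪ξ, y⟫_ℝ)) * Complex.I)) := by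
      rw [map_mul, Complex.conj_ofReal, ← Complex.exp_conj, map_mul, Complex.conj_I,
        Complex.conj_ofReal, smul_eq_mul]
      have he : Complex.exp (↑(2 * Real.pi * (⟪ξ, x⟫_ℝ - ⟪ξ, y⟫_ℝ)) * Complex.I) =
          Complex.exp (↑(-(2 * Real.pi * ⟪ξ, x⟫_ℝ)) * -Complex.I) *
          Complex.exp (↑(-(2 * Real.pi * ⟪ξ, y⟫_ℝ)) * Complex.I) := by
        rw [← Complex.exp_add]; congr 1; push_cast; ring
      rw [he]; push_cast; ring
    rw [this, Complex.re_ofReal_mul]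
    congr 1
    rw [neg_mul, Complex.neg_re, Complex.I_mul_re, neg_neg, Complex.exp_ofReal_mul_I_im]
  rw [integral_congr_ae h]
  have hodd := integral_neg_eq_self (fun ξ : E => besselSymbol τ ξ ^ 2 *
    Real.sin (2 * Real.pi * (⟪ξ, x⟫_ℝ - ⟪ξ, y⟫_ℝ))) volume
  have hneg : ∀ ξ : E, besselSymbol τ (-ξ) ^ 2 *
      Real.sin (2 * Real.pi * (⟪-ξ, x⟫_ℝ - ⟪-ξ, y⟫_ℝ)) = -(besselSymbol τ ξ ^ 2 *
      Real.sin (2 * Real.pi * (⟪ξ, x⟫_ℝ - ⟪ξ, y⟫_ℝ))) := fun ξ => by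
    rw [besselSymbol, norm_neg, inner_neg_left, inner_neg_left, ← besselSymbol,
      show 2 * Real.pi * (-⟪ξ, x⟫_ℝ - -⟪ξ, y⟫_ℝ) = -(2 * Real.pi * (⟪ξ, x⟫_ℝ - ⟪ξ, y⟫_ℝ)) by ring,
      Real.sin_neg, mul_neg]
  simp only [hneg] at hodd
  rw [integral_neg] at hodd
  linarith

end Fourier

/-! ### Norm equivalence of kernel translates and point evaluations -/

section Transfer

open FourierTransform

variable {E : Type*} [NormedAddCommGroup E] [InnerProductSpace ℝ E] [FiniteDimensional ℝ E]
  [MeasurableSpace E] [BorelSpace E] {Ω : Set E} {k : SPDKernel Ω} {τ : ℝ}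
  (hτ : (Module.finrank ℝ E : ℝ) < 2 * τ)

theorem sobolevNormOn_le {f : Ω → ℝ} {g : E → ℝ} {u : Lp ℂ 2 (volume : Measure E)}
    (h : IsSobolevExtension τ f g u) : sobolevNormOn τ f ≤ ‖u‖ :=
  csInf_le ⟨0, by rintro _ ⟨g, u, -, rfl⟩; exact norm_nonneg _⟩ ⟨g, u, h, rfl⟩

theorem exists_frequency_representation (hk : HasFiniteSmoothness k τ) :
    ∃ A : ℝ, 0 < A ∧ ∀ h : k.NativeSpace, ∃ v : Lp ℂ 2 (volume : Measure E),
      ‖v‖ ≤ A * ‖h‖ ∧ ∀ x : Ω, h x = ⟪evalVec hτ (x : E), v⟫_ℝ := by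
  obtain ⟨hmem, a, b, ha, -, hab⟩ := hk
  -- The factor `2` gives strict slack, so that an extension can be chosen without knowing that the
  -- infimum is attained; this is why `h = 0` is treated apart.
  refine ⟨2 / a, by positivity, fun h => ?_⟩
  by_cases h0 : h = 0
  · exact ⟨0, by simp [h0], fun x => by simp [h0]⟩
  · have hpos : 0 < ‖h‖ := norm_pos_iff.mpr h0
    obtain ⟨g₀, u₀, hu₀⟩ := (hmem h).mp ⟨h, rfl⟩
    have hlt : sobolevNormOn τ (⇑h : Ω → ℝ) < 2 / a * ‖h‖ := by
      have := (hab h).1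
      rw [mul_comm, ← le_div_iff₀ ha] at this
      refine this.trans_lt ?_
      rw [div_mul_eq_mul_div]
      gcongr
      linarith
    have hne : {r | ∃ g u, IsSobolevExtension τ (⇑h : Ω → ℝ) g u ∧ r = ‖u‖}.Nonempty :=
      ⟨‖u₀‖, g₀, u₀, hu₀, rfl⟩
    obtain ⟨_, ⟨g, u, hgu, rfl⟩, hu⟩ := exists_lt_of_csInf_lt hne hlt
    refine ⟨𝓕 u, by rw [Lp.norm_fourier_eq]; exact hu.le, fun x => ?_⟩
    rw [← hgu.apply_eq hτ, hgu.2.1]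

theorem exists_nativeSpace_representation (hk : HasFiniteSmoothness k τ) :
    ∃ B : ℝ, 0 < B ∧ ∀ v : Lp ℂ 2 (volume : Measure E),
      (∀ x, ⟪evalVec hτ x, (-Complex.I) • v⟫_ℝ = 0) →
        ∃ h : k.NativeSpace, ‖h‖ ≤ B * ‖v‖ ∧ ∀ x : Ω, h x = ⟪evalVec hτ (x : E), v⟫_ℝ := by
  obtain ⟨hmem, a, b, -, hb, hab⟩ := hk
  refine ⟨b, hb, fun v hv => ?_⟩
  have hext := isSobolevExtension_of_real (Ω := Ω) hτ v hv
  obtain ⟨h, hh⟩ := (hmem _).mpr ⟨_, _, hext⟩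
  refine ⟨h, (hab h).2.trans ?_, fun x => by rw [hh]⟩
  rw [hh]
  have hn : ‖(𝓕⁻ v : Lp ℂ 2 (volume : Measure E))‖ = ‖v‖ := by
    rw [← Lp.norm_fourier_eq, fourier_fourierInv_eq]
  gcongr
  exact (sobolevNormOn_le hext).trans hn.le

theorem inner_linearCombination_eq {h : k.NativeSpace} {v : Lp ℂ 2 (volume : Measure E)}
    (hv : ∀ x : Ω, h x = ⟪evalVec hτ (x : E), v⟫_ℝ) (c : Ω →₀ ℝ) :
    ⟪Finsupp.linearCombination ℝ k.translate c, h⟫_ℝ =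
      ⟪Finsupp.linearCombination ℝ (fun x : Ω => evalVec hτ (x : E)) c, v⟫_ℝ := by
  rw [Finsupp.linearCombination_apply, Finsupp.linearCombination_apply, Finsupp.sum_inner,
    Finsupp.sum_inner]
  refine Finsupp.sum_congr fun x _ => ?_
  rw [real_inner_smul_left, real_inner_smul_left, real_inner_comm, k.inner_translate, hv]

/-- Duality: a combination of translates is tested against itself, and its frequency representation
turns this into a pairing with the same combination of evaluations. The converse estimate below is
symmetric. -/
theorem exists_norm_linearCombination_translate_le (hk : HasFiniteSmoothness k τ) :
    ∃ A : ℝ, 0 < A ∧ ∀ c : Ω →₀ ℝ, ‖Finsupp.linearCombination ℝ k.translate c‖ ≤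
      A * ‖Finsupp.linearCombination ℝ (fun x : Ω => evalVec hτ (x : E)) c‖ := by
  obtain ⟨A, hA, h⟩ := exists_frequency_representation hτ hk
  refine ⟨A, hA, fun c => ?_⟩
  set p := Finsupp.linearCombination ℝ k.translate c with hp
  obtain ⟨v, hv, hpv⟩ := h p
  rcases (norm_nonneg p).eq_or_lt with h0 | h0
  · rw [← h0]; positivity
  · refine le_of_mul_le_mul_right ?_ h0
    calc ‖p‖ * ‖p‖ = ⟪p, p⟫_ℝ := (real_inner_self_eq_norm_mul_norm p).symm
      _ = _ := inner_linearCombination_eq hτ hpv c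
      _ ≤ _ := real_inner_le_norm _ _
      _ ≤ ‖Finsupp.linearCombination ℝ (fun x : Ω => evalVec hτ (x : E)) c‖ * (A * ‖p‖) := by gcongr
      _ = _ := by ring

theorem exists_norm_linearCombination_evalVec_le (hk : HasFiniteSmoothness k τ) :
    ∃ B : ℝ, 0 < B ∧ ∀ c : Ω →₀ ℝ,
      ‖Finsupp.linearCombination ℝ (fun x : Ω => evalVec hτ (x : E)) c‖ ≤
        B * ‖Finsupp.linearCombination ℝ k.translate c‖ := by
  obtain ⟨B, hB, h⟩ := exists_nativeSpace_representation hτ hk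
  refine ⟨B, hB, fun c => ?_⟩
  set v := Finsupp.linearCombination ℝ (fun x : Ω => evalVec hτ (x : E)) c with hv
  obtain ⟨p, hp, hpv⟩ := h v fun x => by
    rw [hv, Finsupp.linearCombination_apply, Finsupp.smul_sum, Finsupp.inner_sum]
    refine Finset.sum_eq_zero fun y _ => ?_
    dsimp only
    rw [smul_comm, inner_smul_right, inner_evalVec_smul_evalVec, mul_zero]
  rcases (norm_nonneg v).eq_or_lt with h0 | h0
  · rw [← h0]; positivity
  · refine le_of_mul_le_mul_right ?_ h0
    calc ‖v‖ * ‖v‖ = ⟪v, v⟫_ℝ := (real_inner_self_eq_norm_mul_norm v).symm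
      _ = _ := (inner_linearCombination_eq hτ hpv c).symm
      _ ≤ _ := real_inner_le_norm _ _
      _ ≤ ‖Finsupp.linearCombination ℝ k.translate c‖ * (B * ‖v‖) := by gcongr
      _ = _ := by ring

theorem norm_evalVec (x y : E) : ‖evalVec hτ x‖ = ‖evalVec hτ y‖ := by
  rw [evalVec, evalVec, Lp.norm_toLp, Lp.norm_toLp]
  congr 1
  refine eLpNorm_congr_norm_ae (ae_of_all _ fun ξ => ?_)
  rw [norm_evalFun, norm_evalFun]

/-- Stabilized greedy selections are weak greedy selections for the point evaluations. -/
theorem exists_isWeakGreedy (hk : HasFiniteSmoothness k τ) :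
    ∃ κ : ℝ, 0 < κ ∧ κ ≤ 1 ∧ ∀ γ : ℝ, 0 < γ → ∀ (η : SelectionCriterion Ω) (f : Ω → ℝ)
      (x : ℕ → Ω) (N : ℕ), IsStabilizedGreedy k γ η f x N →
        IsWeakGreedy (fun x : Ω => evalVec hτ (x : E)) (κ * γ) x N := by
  obtain ⟨A, hA, hA'⟩ := exists_norm_linearCombination_translate_le hτ hk
  obtain ⟨B, hB, hB'⟩ := exists_norm_linearCombination_evalVec_le hτ hk
  -- Passing to translates and back costs `A * B`; the `1` keeps the weak greedy parameter at most
  -- `1` for `γ ≤ 1`.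
  refine ⟨min 1 (A * B)⁻¹, by positivity, min_le_left _ _, fun γ hγ η f x N h n hn y => ?_⟩
  set w := fun x : Ω => evalVec hτ (x : E)
  set X := firstPoints x n
  -- Without boundedness the real supremum would be `0` by default and admissibility would say
  -- nothing.
  have hbdd : BddAbove (Set.range (k.powerFunction X)) := by
    refine ⟨A * ‖evalVec hτ (0 : E)‖, ?_⟩
    rintro _ ⟨z, rfl⟩
    rw [powerFunction_eq_norm_residual, norm_evalVec hτ 0 z]
    refine (norm_residual_le_of_linearCombination _ w hA' X z).trans ?_
    gcongr
    exact norm_residual_le_norm w X z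
  have h1 : γ * k.powerFunction X y ≤ k.powerFunction X (x n) :=
    le_trans (by gcongr; exact le_ciSup hbdd y) (h n hn).1
  rw [powerFunction_eq_norm_residual, powerFunction_eq_norm_residual] at h1
  have h2 := norm_residual_le_of_linearCombination _ w hA' X (x n)
  have h3 := norm_residual_le_of_linearCombination w _ hB' X y
  calc min 1 (A * B)⁻¹ * γ * ‖residual w X y‖
      ≤ (A * B)⁻¹ * γ * (B * ‖residual k.translate X y‖) := by
        gcongr; exact min_le_right _ _
    _ = A⁻¹ * (γ * ‖residual k.translate X y‖) := by field_simp
    _ ≤ A⁻¹ * (A * ‖residual w X (x n)‖) :=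
        mul_le_mul_of_nonneg_left (h1.trans h2) (by positivity)
    _ = _ := by field_simp

end Transfer

/-! ### Scale-dependent decay in `L²` -/

theorem weight_le_of_one_le {τ r a : ℝ} (hτ : 0 ≤ τ) (hr : 0 < r) (h : 1 ≤ r * a) :
    (1 + a ^ 2) ^ (-τ) ≤ (2 * r ^ 2) ^ τ * (1 + (r * a) ^ 2) ^ (-τ) := by
  rw [Real.rpow_neg (by positivity), Real.rpow_neg (by positivity), ← div_eq_mul_inv,
    le_div_iff₀ (by positivity), inv_mul_le_iff₀ (by positivity),
    ← Real.mul_rpow (by positivity) (by positivity)]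
  refine Real.rpow_le_rpow (by positivity) ?_ hτ
  nlinarith [one_le_pow₀ h (n := 2)]

/-- At frequencies below `1 / r`, a Taylor remainder of order `m ≥ τ` compensates for the weight.
Together with the high-frequency case this gives one majorant, the weight dilated by `r` times `r ^
(2 τ)`. -/
theorem weight_mul_pow_le {τ r a : ℝ} {m : ℕ} (hτ : 0 ≤ τ) (hm : τ ≤ m) (hr : 0 < r)
    (ha : 0 ≤ a) (h : r * a ≤ 1) :
    (1 + a ^ 2) ^ (-τ) * ((r * a) ^ m) ^ 2 ≤ (2 * r ^ 2) ^ τ * (1 + (r * a) ^ 2) ^ (-τ) := by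
  have h0 : 0 ≤ (r * a) ^ 2 := by positivity
  have h1 : (r * a) ^ 2 ≤ 1 := pow_le_one₀ (by positivity) h
  have h2 : ((r * a) ^ m) ^ 2 ≤ ((r * a) ^ 2) ^ τ := by
    rw [← pow_mul, mul_comm m 2, pow_mul, ← Real.rpow_natCast]
    rcases h0.eq_or_lt with h0 | h0
    · rw [← h0]
      rcases hτ.eq_or_lt with rfl | hτ
      · rw [Real.rpow_zero]; exact Real.rpow_le_one le_rfl zero_le_one (by positivity)
      · rw [Real.zero_rpow (hτ.trans_le hm).ne', Real.zero_rpow hτ.ne']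
    · exact Real.rpow_le_rpow_of_exponent_ge h0 h1 hm
  rw [Real.rpow_neg (by positivity), Real.rpow_neg (by positivity), ← div_eq_mul_inv,
    le_div_iff₀ (by positivity), mul_assoc, inv_mul_le_iff₀ (by positivity),
    ← Real.mul_rpow (by positivity) (by positivity)]
  refine (mul_le_mul_of_nonneg_right h2 (by positivity)).trans ?_
  rw [← Real.mul_rpow (by positivity) (by positivity)]
  refine Real.rpow_le_rpow (by positivity) ?_ hτ
  nlinarith [sq_nonneg r]

/-! ### Dilated bump functions on the Fourier side -/

theorem exists_schwartz_decay {E : Type*} [NormedAddCommGroup E] [InnerProductSpace ℝ E]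
    (ψ : 𝓢(E, ℂ)) (p : ℝ) :
    ∃ C : ℝ, 0 < C ∧ ∀ η, ‖ψ η‖ ^ 2 * (1 + ‖η‖ ^ 2) ^ p ≤ C := by
  let k := ⌈p⌉₊
  let S := 2 ^ k * (Finset.Iic (k, 0)).sup (fun m => SchwartzMap.seminorm ℝ m.1 m.2) ψ
  refine ⟨S ^ 2 + 1, by positivity, fun η => ?_⟩
  have h1 : (1 + ‖η‖) ^ k * ‖ψ η‖ ≤ S := by
    have := SchwartzMap.one_add_le_sup_seminorm_apply (𝕜 := ℝ) (m := (k, 0)) le_rfl le_rfl ψ η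
    simpa using this
  have h2 : (1 + ‖η‖ ^ 2) ^ p ≤ ((1 + ‖η‖) ^ k) ^ 2 := by
    calc (1 + ‖η‖ ^ 2) ^ p ≤ (1 + ‖η‖ ^ 2) ^ (k : ℝ) :=
          Real.rpow_le_rpow_of_exponent_le (by nlinarith [norm_nonneg η]) (Nat.le_ceil p)
      _ = (1 + ‖η‖ ^ 2) ^ k := Real.rpow_natCast _ _
      _ ≤ ((1 + ‖η‖) ^ 2) ^ k := by gcongr; nlinarith [norm_nonneg η]
      _ = _ := by rw [← pow_mul, ← pow_mul, mul_comm]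
  calc ‖ψ η‖ ^ 2 * (1 + ‖η‖ ^ 2) ^ p ≤ ‖ψ η‖ ^ 2 * ((1 + ‖η‖) ^ k) ^ 2 := by gcongr
    _ = ((1 + ‖η‖) ^ k * ‖ψ η‖) ^ 2 := by ring
    _ ≤ S ^ 2 := by gcongr
    _ ≤ _ := by linarith

/-- The Fourier representative of the dilated and translated inverse Fourier transform of `ψ`. -/
def dilateFun {E : Type*} [NormedAddCommGroup E] [InnerProductSpace ℝ E]
    (τ ρ : ℝ) (x : E) (ψ : 𝓢(E, ℂ)) (ξ : E) : ℂ :=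
  (ρ ^ Module.finrank ℝ E : ℝ) * (evalFun (-τ) x ξ * ψ (ρ • ξ))

theorem continuous_dilateFun {E : Type*} [NormedAddCommGroup E] [InnerProductSpace ℝ E]
    (τ ρ : ℝ) (x : E) (ψ : 𝓢(E, ℂ)) :
    Continuous (dilateFun τ ρ x ψ) := by
  have := continuous_evalFun (-τ) x
  unfold dilateFun
  fun_prop

/-- The inverse symbol grows with order `τ` and the squared Schwartz factor decays with order `2 τ`.
The bound `P` enters through `1 + |ξ|² ≤ (P² / ρ²) (1 + |ρ ξ|²)`. -/
theorem norm_dilateFun_sq_le {E : Type*} [NormedAddCommGroup E] [InnerProductSpace ℝ E]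
    {τ : ℝ} (hτ : 0 ≤ τ) {P C ρ : ℝ} (hP : 1 ≤ P) (hρ : 0 < ρ)
    (hρP : ρ ≤ P) (x : E) {ψ : 𝓢(E, ℂ)} (hψ : ∀ η, ‖ψ η‖ ^ 2 * (1 + ‖η‖ ^ 2) ^ (2 * τ) ≤ C)
    (ξ : E) : ‖dilateFun τ ρ x ψ ξ‖ ^ 2 ≤
      ((ρ ^ Module.finrank ℝ E) ^ 2 * C * (P ^ 2 / ρ ^ 2) ^ τ) * (1 + ‖ρ • ξ‖ ^ 2) ^ (-τ) := by
  rw [dilateFun, norm_mul, norm_mul, norm_evalFun, Complex.norm_real,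
    Real.norm_of_nonneg (by positivity), mul_pow, mul_pow, besselSymbol_sq, neg_neg, mul_assoc,
    mul_assoc]
  refine mul_le_mul_of_nonneg_left ?_ (by positivity)
  set t := 1 + ‖ρ • ξ‖ ^ 2 with ht
  have ht0 : 0 < t := by positivity
  have h1 : (1 + ‖ξ‖ ^ 2) ^ τ ≤ (P ^ 2 / ρ ^ 2) ^ τ * t ^ τ := by
    rw [← Real.mul_rpow (by positivity) ht0.le]
    refine Real.rpow_le_rpow (by positivity) ?_ hτ
    rw [div_mul_eq_mul_div, le_div_iff₀ (by positivity), ht, norm_smul,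
      Real.norm_of_nonneg hρ.le]
    have h3 : ρ ^ 2 ≤ P ^ 2 := by gcongr
    have h4 : 1 ≤ P ^ 2 := one_le_pow₀ hP
    nlinarith [mul_nonneg (sub_nonneg.mpr h4) (sq_nonneg (ρ * ‖ξ‖))]
  have h2 : ‖ψ (ρ • ξ)‖ ^ 2 ≤ C * (t ^ τ)⁻¹ * t ^ (-τ) := by
    rw [Real.rpow_neg ht0.le, mul_assoc, ← mul_inv, ← div_eq_mul_inv, le_div_iff₀ (by positivity),
      ← Real.rpow_add ht0, ← two_mul]
    exact hψ _
  calc (1 + ‖ξ‖ ^ 2) ^ τ * ‖ψ (ρ • ξ)‖ ^ 2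
      ≤ ((P ^ 2 / ρ ^ 2) ^ τ * t ^ τ) * (C * (t ^ τ)⁻¹ * t ^ (-τ)) := by gcongr
    _ = _ := by
      have : t ^ τ ≠ 0 := by positivity
      field_simp

section Decay

open FourierTransform
open scoped ContDiff

variable {E : Type*} [NormedAddCommGroup E] [InnerProductSpace ℝ E] [FiniteDimensional ℝ E]
  [MeasurableSpace E] [BorelSpace E] {τ : ℝ}

/-- The integral of the weight `(1 + |ξ|²) ^ (-τ)`. -/
def weightIntegral (E : Type*) [NormedAddCommGroup E] [InnerProductSpace ℝ E]
    [FiniteDimensional ℝ E] [MeasurableSpace E] [BorelSpace E] (τ : ℝ) : ℝ :=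
  ∫ ξ : E, (1 + ‖ξ‖ ^ 2) ^ (-τ)

theorem weightIntegral_nonneg : 0 ≤ weightIntegral E τ :=
  integral_nonneg fun ξ => by positivity

theorem integrable_weight (hτ : (Module.finrank ℝ E : ℝ) < 2 * τ) :
    Integrable fun ξ : E => (1 + ‖ξ‖ ^ 2) ^ (-τ) := by
  refine (integrable_rpow_neg_one_add_norm_sq hτ).congr (ae_of_all _ fun ξ => ?_)
  dsimp only
  congr 1
  ring

theorem integrable_weight_smul (hτ : (Module.finrank ℝ E : ℝ) < 2 * τ) {r : ℝ} (hr : 0 < r) :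
    Integrable fun ξ : E => (1 + ‖r • ξ‖ ^ 2) ^ (-τ) :=
  (integrable_weight hτ).comp_smul hr.ne'

theorem norm_sq_eq_integral (v : Lp ℂ 2 (volume : Measure E)) : ‖v‖ ^ 2 = ∫ ξ, ‖v ξ‖ ^ 2 := by
  rw [← real_inner_self_eq_norm_sq, L2.inner_def]
  simp only [real_inner_self_eq_norm_sq]

theorem norm_sq_le_of_decay (hτ : (Module.finrank ℝ E : ℝ) < 2 * τ) {r c : ℝ} (hr : 0 < r)
    {v : Lp ℂ 2 (volume : Measure E)}
    (hv : ∀ᵐ ξ, ‖v ξ‖ ^ 2 ≤ c * (1 + ‖r • ξ‖ ^ 2) ^ (-τ)) :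
    ‖v‖ ^ 2 ≤ c * (r ^ Module.finrank ℝ E)⁻¹ * weightIntegral E τ := by
  rw [norm_sq_eq_integral]
  refine (integral_mono_ae ?_ ((integrable_weight_smul hτ hr).const_mul c) hv).trans ?_
  · have := (Lp.memLp v).integrable_norm_pow (by norm_num)
    simpa using this
  · rw [integral_const_mul, Measure.integral_comp_smul volume
      (fun ξ : E => (1 + ‖ξ‖ ^ 2) ^ (-τ)), abs_of_nonneg (by positivity), smul_eq_mul, mul_assoc]
    rfl

theorem exists_schwartz_fourierInv_bump (E : Type*) [NormedAddCommGroup E] [InnerProductSpace ℝ E]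
    [FiniteDimensional ℝ E] [MeasurableSpace E] [BorelSpace E] :
    ∃ ψ : 𝓢(E, ℂ), 𝓕⁻ (ψ : E → ℂ) 0 = 1 ∧ ∀ y, 1 ≤ ‖y‖ → 𝓕⁻ (ψ : E → ℂ) y = 0 := by
  let f : ContDiffBump (0 : E) := ⟨1 / 2, 1, by norm_num, by norm_num⟩
  have h₁ : HasCompactSupport (Complex.ofRealCLM ∘ f) := f.hasCompactSupport.comp_left rfl
  have h₂ : ContDiff ℝ ∞ (Complex.ofRealCLM ∘ f) := Complex.ofRealCLM.contDiff.comp f.contDiff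
  let φ : 𝓢(E, ℂ) := h₁.toSchwartzMap h₂
  have hφ : ∀ y, 𝓕⁻ ((𝓕 φ : 𝓢(E, ℂ)) : E → ℂ) y = f y := fun y => by
    rw [← SchwartzMap.fourierInv_coe, FourierTransform.fourierInv_fourier_eq]
    simp [φ]
  refine ⟨𝓕 φ, ?_, fun y hy => ?_⟩
  · rw [hφ, f.one_of_mem_closedBall (by simp [f])]; simp
  · rw [hφ, f.zero_of_le_dist (by simpa [f] using hy)]; simp

theorem memLp_dilateFun (hτ : (Module.finrank ℝ E : ℝ) < 2 * τ) {ρ : ℝ} (hρ : 0 < ρ) (x : E)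
    (ψ : 𝓢(E, ℂ)) : MemLp (dilateFun τ ρ x ψ) 2 := by
  obtain ⟨C, hC, hψ⟩ := exists_schwartz_decay ψ (2 * τ)
  have hc := (continuous_dilateFun τ ρ x ψ).aestronglyMeasurable (μ := volume)
  rw [memLp_two_iff_integrable_sq_norm hc]
  refine Integrable.mono' ((integrable_weight_smul hτ hρ).const_mul
    ((ρ ^ Module.finrank ℝ E) ^ 2 * C * ((max 1 ρ) ^ 2 / ρ ^ 2) ^ τ)) (hc.norm.pow 2)
    (ae_of_all _ fun ξ => ?_)
  rw [Real.norm_of_nonneg (by positivity)]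
  exact norm_dilateFun_sq_le (order_nonneg hτ) (le_max_left _ _) hρ (le_max_right _ _) x hψ ξ

/-- The symbols of orders `τ` and `-τ` cancel, and substituting `ρ ξ` absorbs the factor `ρ ^ n`. -/
theorem inner_dilateFun (hτ : (Module.finrank ℝ E : ℝ) < 2 * τ) {ρ : ℝ} (hρ : 0 < ρ) (x y : E)
    (ψ : 𝓢(E, ℂ)) : ⟪(memLp_dilateFun hτ hρ x ψ).toLp, evalVec hτ y⟫_ℝ =
      (𝓕⁻ (ψ : E → ℂ) (ρ⁻¹ • (y - x))).re := by
  rw [real_inner_comm, inner_evalVec]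
  congr 1
  let G : E → ℂ := fun η =>
    Complex.exp (↑(2 * Real.pi * ⟪η, ρ⁻¹ • (y - x)⟫_ℝ) * Complex.I) • ψ η
  rw [Real.fourierInv_eq', Real.fourierInv_eq']
  have h : ∀ᵐ ξ : E, Complex.exp (↑(2 * Real.pi * ⟪ξ, y⟫_ℝ) * Complex.I) •
      ((besselSymbol τ ξ : ℂ) * (memLp_dilateFun hτ hρ x ψ).toLp _ ξ) =
      ((ρ ^ Module.finrank ℝ E : ℝ) : ℂ) * G (ρ • ξ) := by
    filter_upwards [(memLp_dilateFun hτ hρ x ψ).coeFn_toLp] with ξ hξ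
    rw [hξ, dilateFun, evalFun]
    simp only [G, smul_eq_mul]
    have he : Complex.exp (↑(2 * Real.pi * ⟪ρ • ξ, ρ⁻¹ • (y - x)⟫_ℝ) * Complex.I) =
        Complex.exp (↑(2 * Real.pi * ⟪ξ, y⟫_ℝ) * Complex.I) *
        Complex.exp (↑(-(2 * Real.pi * ⟪ξ, x⟫_ℝ)) * Complex.I) := by
      rw [← Complex.exp_add, real_inner_smul_left, real_inner_smul_right, inner_sub_right,
        mul_inv_cancel_left₀ hρ.ne']
      congr 1; push_cast; ring
    have hb : (besselSymbol τ ξ : ℂ) * (besselSymbol (-τ) ξ : ℂ) = 1 := by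
      rw [← Complex.ofReal_mul, besselSymbol, besselSymbol, ← Real.rpow_add (by positivity)]
      ring_nf
      simp
    rw [he]
    linear_combination (Complex.exp (↑(2 * Real.pi * ⟪ξ, y⟫_ℝ) * Complex.I) *
      ((ρ ^ Module.finrank ℝ E : ℝ) : ℂ) *
      Complex.exp (↑(-(2 * Real.pi * ⟪ξ, x⟫_ℝ)) * Complex.I) * ψ (ρ • ξ)) * hb
  rw [integral_congr_ae h, integral_const_mul, Measure.integral_comp_smul,
    abs_of_nonneg (by positivity), ← Complex.coe_smul, smul_eq_mul, ← mul_assoc,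
    ← Complex.ofReal_mul, mul_inv_cancel₀ (by positivity), Complex.ofReal_one, one_mul]

/-- Test functions in `L²` which separate a point from the points at distance at least `ρ`. -/
theorem exists_separating (hτ : (Module.finrank ℝ E : ℝ) < 2 * τ) {P : ℝ} (hP : 1 ≤ P) :
    ∃ C : ℝ, 0 < C ∧ ∀ ρ : ℝ, 0 < ρ → ρ ≤ P → ∀ x : E, ∃ u : Lp ℂ 2 (volume : Measure E),
      ‖u‖ ≤ C * ρ ^ ((Module.finrank ℝ E : ℝ) / 2 - τ) ∧ ⟪u, evalVec hτ x⟫_ℝ = 1 ∧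
        ∀ y, ρ ≤ ‖y - x‖ → ⟪u, evalVec hτ y⟫_ℝ = 0 := by
  obtain ⟨ψ, hψ0, hψ1⟩ := exists_schwartz_fourierInv_bump E
  obtain ⟨C, hC, hψ⟩ := exists_schwartz_decay ψ (2 * τ)
  set n := Module.finrank ℝ E with hn
  set K := C * (P ^ 2) ^ τ * weightIntegral E τ with hK
  have hK0 : 0 ≤ K := by
    have : 0 ≤ weightIntegral E τ := weightIntegral_nonneg
    positivity
  refine ⟨√K + 1, by positivity, fun ρ hρ hρP x => ⟨(memLp_dilateFun hτ hρ x ψ).toLp, ?_, ?_, ?_⟩⟩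
  · have hle : ‖(memLp_dilateFun hτ hρ x ψ).toLp‖ ^ 2 ≤ K * (ρ ^ ((n : ℝ) / 2 - τ)) ^ 2 := by
      refine (norm_sq_le_of_decay hτ hρ (v := (memLp_dilateFun hτ hρ x ψ).toLp)
        (c := (ρ ^ n) ^ 2 * C * (P ^ 2 / ρ ^ 2) ^ τ) ?_).trans (le_of_eq ?_)
      · filter_upwards [(memLp_dilateFun hτ hρ x ψ).coeFn_toLp] with ξ hξ
        rw [hξ]
        exact norm_dilateFun_sq_le (order_nonneg hτ) hP hρ hρP x hψ ξ
      · have h1 : (ρ ^ ((n : ℝ) / 2 - τ)) ^ 2 = ρ ^ n / (ρ ^ 2) ^ τ := by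
          rw [← Real.rpow_mul_natCast hρ.le, ← Real.rpow_natCast ρ 2, ← Real.rpow_mul hρ.le,
            ← Real.rpow_natCast ρ n, ← Real.rpow_sub hρ]
          congr 1; push_cast; ring
        rw [h1, Real.div_rpow (by positivity) (by positivity), hK, ← hn]
        field_simp
    have hr : 0 < ρ ^ ((n : ℝ) / 2 - τ) := by positivity
    calc ‖(memLp_dilateFun hτ hρ x ψ).toLp‖ ≤ √(K * (ρ ^ ((n : ℝ) / 2 - τ)) ^ 2) :=
          Real.le_sqrt_of_sq_le hle
      _ = √K * ρ ^ ((n : ℝ) / 2 - τ) := by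
          rw [Real.sqrt_mul hK0, Real.sqrt_sq hr.le]
      _ ≤ _ := by gcongr; linarith
  · rw [inner_dilateFun hτ hρ, sub_self, smul_zero, hψ0, Complex.one_re]
  · intro y hy
    rw [inner_dilateFun hτ hρ, hψ1, Complex.zero_re]
    rw [norm_smul, norm_inv, Real.norm_of_nonneg hρ.le, ← div_eq_inv_mul, one_le_div hρ]
    exact hy

end Decay

/-! ### Widths of the set of point evaluations -/

theorem exists_abs_sub_grid_le {R t : ℝ} (hR : 0 < R) (ht : |t| ≤ R) {q : ℕ} (hq : 0 < q) :
    ∃ i : Fin q, |t - R * (2 * (i : ℕ) / q - 1)| ≤ 2 * R / q := by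
  have hq' : (0 : ℝ) < q := by exact_mod_cast hq
  obtain ⟨h1, h2⟩ := abs_le.mp ht
  set u := (t + R) * q / (2 * R) with hu
  have hu0 : 0 ≤ u := by
    have : 0 ≤ t + R := by linarith
    positivity
  have huq : u ≤ q := by
    rw [hu, div_le_iff₀ (by positivity)]; nlinarith
  have key : ∀ i : ℕ, |u - i| ≤ 1 → |t - R * (2 * i / q - 1)| ≤ 2 * R / q := by
    intro i hi
    have : t - R * (2 * i / q - 1) = 2 * R / q * (u - i) := by rw [hu]; field_simp; ring
    rw [this, abs_mul, abs_of_nonneg (by positivity)]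
    exact mul_le_of_le_one_right (by positivity) hi
  -- The grid omits the right endpoint, so `t = R` is assigned to the last node `q - 1`.
  rcases huq.eq_or_lt with h | h
  · refine ⟨⟨q - 1, by omega⟩, key _ ?_⟩
    rw [h]
    push_cast [Nat.cast_sub (show 1 ≤ q from hq)]
    simp
  · refine ⟨⟨⌊u⌋₊, (Nat.floor_lt hu0).mpr h⟩, key _ ?_⟩
    rw [abs_le]
    have := Nat.floor_le hu0
    have := Nat.lt_floor_add_one u
    constructor <;> simp only <;> linarith

/-- The node with index `i` of a grid with `q ^ d` nodes in the cube of side length `2 R`. -/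
def gridPoint {d : ℕ} (R : ℝ) (q : ℕ) (i : Fin d → Fin q) : EuclideanSpace ℝ (Fin d) :=
  WithLp.toLp 2 fun a => R * (2 * (i a : ℕ) / q - 1)

theorem exists_norm_sub_gridPoint_le {d : ℕ} (hd : 1 ≤ d) {R : ℝ} (hR : 0 < R)
    {x : EuclideanSpace ℝ (Fin d)} (hx : ‖x‖ ≤ R) {q : ℕ} (hq : 0 < q) :
    ∃ i : Fin d → Fin q, ‖x - gridPoint R q i‖ ≤ d * (2 * R / q) := by
  have hxa : ∀ a, |x a| ≤ R := fun a => (PiLp.norm_apply_le x a).trans hx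
  choose i hi using fun a => exists_abs_sub_grid_le hR (hxa a) hq
  refine ⟨i, ?_⟩
  rw [← sq_le_sq₀ (norm_nonneg _) (by positivity), EuclideanSpace.norm_sq_eq]
  have hd' : (1 : ℝ) ≤ d := by exact_mod_cast hd
  calc ∑ a, ‖(x - gridPoint R q i) a‖ ^ 2 ≤ ∑ _a : Fin d, (2 * R / q) ^ 2 := by
        refine Finset.sum_le_sum fun a _ => ?_
        gcongr
        exact hi a
    _ = d * (2 * R / q) ^ 2 := by simp
    _ ≤ _ := by rw [mul_pow]; gcongr; nlinarith

/-! ### Local Taylor approximation of point evaluations -/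

section Truncation

variable {d : ℕ} {τ : ℝ}

theorem memLp_truncation (hτ : (Module.finrank ℝ (EuclideanSpace ℝ (Fin d)) : ℝ) < 2 * τ) (R : ℝ)
    (z : EuclideanSpace ℝ (Fin d)) (φ : C(EuclideanSpace ℝ (Fin d), ℂ)) :
    MemLp ((Metric.closedBall 0 R).indicator fun ξ => evalFun τ z ξ * φ ξ) 2 := by
  obtain ⟨C, hC⟩ := (isCompact_closedBall (0 : EuclideanSpace ℝ (Fin d))
    R).exists_bound_of_continuousOn φ.continuous.continuousOn
  refine (memLp_evalFun hτ z).of_le_mul (c := max C 0)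
    (((continuous_evalFun τ z).mul φ.continuous).aestronglyMeasurable.indicator
      measurableSet_closedBall) (ae_of_all _ fun ξ => ?_)
  by_cases hξ : ξ ∈ Metric.closedBall (0 : EuclideanSpace ℝ (Fin d)) R
  · rw [Set.indicator_of_mem hξ, norm_mul, mul_comm]
    gcongr
    exact (hC ξ hξ).trans (le_max_left _ _)
  · rw [Set.indicator_of_notMem hξ, norm_zero]
    positivity

/-- Multiplication of the evaluation at `z` by a continuous function, restricted to a ball of
frequencies. -/
def truncation (hτ : (Module.finrank ℝ (EuclideanSpace ℝ (Fin d)) : ℝ) < 2 * τ) (R : ℝ)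
    (z : EuclideanSpace ℝ (Fin d)) :
    C(EuclideanSpace ℝ (Fin d), ℂ) →ₗ[ℝ] Lp ℂ 2 (volume : Measure (EuclideanSpace ℝ (Fin d))) where
  toFun φ := (memLp_truncation hτ R z φ).toLp
  map_add' φ ψ := by
    rw [← MemLp.toLp_add]
    congr 1
    ext ξ
    simp only [Set.indicator, Pi.add_apply, ContinuousMap.add_apply]
    split_ifs <;> ring
  map_smul' c φ := by
    rw [RingHom.id_apply, ← MemLp.toLp_const_smul]
    congr 1
    ext ξ
    simp only [Set.indicator, Pi.smul_apply, ContinuousMap.smul_apply, Complex.real_smul]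
    split_ifs
    · ring
    · simp

/-- The monomials in the Taylor expansions of plane waves. -/
def waveMonomial {m : ℕ} (p : Σ j : Fin m, Fin (j : ℕ) → Fin d) :
    C(EuclideanSpace ℝ (Fin d), ℂ) where
  toFun ξ := (-(2 * Real.pi * Complex.I)) ^ (p.1 : ℕ) / (p.1 : ℕ).factorial *
    ∏ t, (ξ (p.2 t) : ℂ)
  continuous_toFun := by fun_prop

/-- The Taylor polynomial of the plane wave `ξ ↦ exp (-2 π i ⟪ξ, y⟫)`. -/
def waveTaylor (m : ℕ) (y : EuclideanSpace ℝ (Fin d)) : C(EuclideanSpace ℝ (Fin d), ℂ) :=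
  ∑ p : (Σ j : Fin m, Fin (j : ℕ) → Fin d), (∏ t, y (p.2 t)) • waveMonomial p

theorem waveTaylor_apply (m : ℕ) (y ξ : EuclideanSpace ℝ (Fin d)) :
    waveTaylor m y ξ = ∑ j ∈ Finset.range m,
      ((-(2 * Real.pi * ⟪ξ, y⟫_ℝ) : ℝ) * Complex.I) ^ j / j.factorial := by
  rw [waveTaylor, ContinuousMap.sum_apply, Fintype.sum_sigma, Finset.sum_range]
  refine Finset.sum_congr rfl fun j _ => ?_
  have h1 : (⟪ξ, y⟫_ℝ) ^ (j : ℕ) = ∑ c : Fin (j : ℕ) → Fin d, (∏ t, y (c t)) * ∏ t, ξ (c t) := by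
    rw [PiLp.inner_apply, ← Fin.prod_const, Finset.prod_univ_sum, Fintype.piFinset_univ]
    refine Finset.sum_congr rfl fun c _ => ?_
    rw [← Finset.prod_mul_distrib]
    refine Finset.prod_congr rfl fun t _ => ?_
    simp
  have h2 : ((-(2 * Real.pi * ⟪ξ, y⟫_ℝ) : ℝ) * Complex.I) ^ (j : ℕ) =
      (-(2 * Real.pi * Complex.I)) ^ (j : ℕ) * ((⟪ξ, y⟫_ℝ ^ (j : ℕ) : ℝ) : ℂ) := by
    push_cast
    rw [← mul_pow]
    congr 1
    ring
  rw [h2, h1, Complex.ofReal_sum, Finset.mul_sum, Finset.sum_div]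
  refine Finset.sum_congr rfl fun c _ => ?_
  rw [ContinuousMap.smul_apply, Complex.real_smul, waveMonomial, ContinuousMap.coe_mk]
  push_cast
  ring

/-- For `|ξ| ≤ 1 / r` the evaluations at `x` and `z` differ by a plane wave with phase at most `2 π
r |ξ|`, and Taylor's remainder applies; above that frequency the symbol itself is small. -/
theorem norm_evalFun_sub_truncation_sq_le (hτ : 0 ≤ τ) {m : ℕ} (hm : τ ≤ m) {r : ℝ} (hr : 0 < r)
    {x z : EuclideanSpace ℝ (Fin d)} (hxz : ‖x - z‖ ≤ r) (ξ : EuclideanSpace ℝ (Fin d)) :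
    ‖evalFun τ x ξ - (Metric.closedBall 0 r⁻¹).indicator
      (fun ξ => evalFun τ z ξ * waveTaylor m (x - z) ξ) ξ‖ ^ 2 ≤
      ((2 * Real.pi) ^ m * Real.exp (2 * Real.pi)) ^ 2 * (2 * r ^ 2) ^ τ *
        (1 + ‖r • ξ‖ ^ 2) ^ (-τ) := by
  have hns : ‖r • ξ‖ = r * ‖ξ‖ := by rw [norm_smul, Real.norm_of_nonneg hr.le]
  rw [hns]
  set K := (2 * Real.pi) ^ m * Real.exp (2 * Real.pi) with hK
  have hpi : 1 ≤ 2 * Real.pi := by linarith [Real.pi_gt_three]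
  have hK1 : 1 ≤ K := one_le_mul_of_one_le_of_one_le (one_le_pow₀ hpi)
    (Real.one_le_exp (by positivity))
  by_cases hξ : ξ ∈ Metric.closedBall (0 : EuclideanSpace ℝ (Fin d)) r⁻¹
  · have hrξ : r * ‖ξ‖ ≤ 1 := by
      rw [mem_closedBall_zero_iff] at hξ
      rwa [← le_div_iff₀' hr, one_div]
    rw [Set.indicator_of_mem hξ]
    set θ : ℂ := (-(2 * Real.pi * ⟪ξ, x - z⟫_ℝ) : ℝ) * Complex.I with hθ
    have hx : evalFun τ x ξ = evalFun τ z ξ * Complex.exp θ := by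
      rw [evalFun, evalFun, mul_assoc (besselSymbol τ ξ : ℂ), ← Complex.exp_add, hθ, inner_sub_right]
      congr 2; push_cast; ring
    have hθn : ‖θ‖ ≤ 2 * Real.pi * (r * ‖ξ‖) := by
      rw [hθ, norm_mul, Complex.norm_I, mul_one, Complex.norm_real, norm_neg, norm_mul,
        Real.norm_of_nonneg (by positivity : (0 : ℝ) ≤ 2 * Real.pi)]
      gcongr
      refine (norm_inner_le_norm ξ (x - z)).trans ?_
      rw [mul_comm]
      gcongr
    have hE : ‖Complex.exp θ - waveTaylor m (x - z) ξ‖ ≤ K * (r * ‖ξ‖) ^ m := by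
      rw [waveTaylor_apply]
      refine (Complex.norm_exp_sub_sum_le_norm_mul_exp θ m).trans ?_
      calc ‖θ‖ ^ m * Real.exp ‖θ‖
          ≤ (2 * Real.pi * (r * ‖ξ‖)) ^ m * Real.exp (2 * Real.pi) := by
            gcongr
            exact hθn.trans (mul_le_of_le_one_right (by positivity) hrξ)
        _ = _ := by rw [hK]; ring
    rw [hx, ← mul_sub, norm_mul, norm_evalFun, mul_pow, besselSymbol_sq]
    calc (1 + ‖ξ‖ ^ 2) ^ (-τ) * ‖Complex.exp θ - waveTaylor m (x - z) ξ‖ ^ 2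
        ≤ (1 + ‖ξ‖ ^ 2) ^ (-τ) * (K * (r * ‖ξ‖) ^ m) ^ 2 := by gcongr
      _ = K ^ 2 * ((1 + ‖ξ‖ ^ 2) ^ (-τ) * ((r * ‖ξ‖) ^ m) ^ 2) := by ring
      _ ≤ K ^ 2 * ((2 * r ^ 2) ^ τ * (1 + (r * ‖ξ‖) ^ 2) ^ (-τ)) := by
          exact mul_le_mul_of_nonneg_left (weight_mul_pow_le hτ hm hr (norm_nonneg _) hrξ)
            (by positivity)
      _ = _ := by ring
  · have hrξ : 1 ≤ r * ‖ξ‖ := by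
      rw [mem_closedBall_zero_iff, not_le] at hξ
      rw [← div_le_iff₀' hr, one_div]
      exact hξ.le
    rw [Set.indicator_of_notMem hξ, sub_zero, norm_evalFun, besselSymbol_sq, mul_assoc]
    refine (weight_le_of_one_le hτ hr hrξ).trans ?_
    exact le_mul_of_one_le_left (by positivity) (one_le_pow₀ hK1)

/-- Each of the `2 ^ (j d)` grid nodes carries the same number `M` of truncated monomials. With `r`
of order `2 ^ (-j)`, the pointwise error has `L²` norm of order `r ^ (τ - d / 2)`: `r ^ τ` from the
majorant and `r ^ (-d / 2)` from dilating its integral. -/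
theorem exists_widths (hd : 1 ≤ d)
    (hτ : (Module.finrank ℝ (EuclideanSpace ℝ (Fin d)) : ℝ) < 2 * τ)
    {R : ℝ} (hR : 0 < R) :
    ∃ (C : ℝ) (M : ℕ), 0 < C ∧ 0 < M ∧ ∀ j : ℕ,
      ∃ W : Submodule ℝ (Lp ℂ 2 (volume : Measure (EuclideanSpace ℝ (Fin d)))),
        FiniteDimensional ℝ W ∧ Module.finrank ℝ W ≤ M * 2 ^ (j * d) ∧
        ∀ x : EuclideanSpace ℝ (Fin d), ‖x‖ ≤ R → ∃ v ∈ W,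
          ‖evalVec hτ x - v‖ ≤ C * ((2 : ℝ) ^ ((d : ℝ) / 2 - τ)) ^ j := by
  set m := ⌈τ⌉₊ + 1 with hm
  have hτm : τ ≤ m := by
    rw [hm]; push_cast
    linarith [Nat.le_ceil τ]
  have hτ0 := order_nonneg hτ
  set K := ((2 * Real.pi) ^ m * Real.exp (2 * Real.pi)) ^ 2 with hK
  set J := weightIntegral (EuclideanSpace ℝ (Fin d)) τ with hJ
  have hJ0 : 0 ≤ J := weightIntegral_nonneg
  set r₀ := (d : ℝ) * (2 * R) with hr₀
  have hd' : (0 : ℝ) < d := by exact_mod_cast hd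
  have hr₀pos : 0 < r₀ := by positivity
  set C := √(K * 2 ^ τ * J) * r₀ ^ (τ - (d : ℝ) / 2) with hC
  refine ⟨C + 1, Fintype.card (Σ j : Fin m, Fin (j : ℕ) → Fin d), by positivity,
    Fintype.card_pos_iff.mpr ⟨⟨⟨0, by omega⟩, fun t => t.elim0⟩⟩, fun j => ?_⟩
  set q := 2 ^ j with hq
  set r := r₀ / q with hr
  have hqpos : (0 : ℝ) < (q : ℕ) := by positivity
  have hrpos : 0 < r := by positivity
  let B : (Fin d → Fin q) × (Σ j : Fin m, Fin (j : ℕ) → Fin d) →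
      Lp ℂ 2 (volume : Measure (EuclideanSpace ℝ (Fin d))) :=
    fun p => truncation hτ r⁻¹ (gridPoint R q p.1) (waveMonomial p.2)
  refine ⟨Submodule.span ℝ (Set.range B), FiniteDimensional.span_of_finite ℝ (Set.finite_range B),
    ?_, fun x hx => ?_⟩
  · refine (finrank_range_le_card B).trans ?_
    rw [Fintype.card_prod, mul_comm, Fintype.card_fun, Fintype.card_fin, Fintype.card_fin, hq,
      ← pow_mul]
  · obtain ⟨i, hi⟩ := exists_norm_sub_gridPoint_le hd hR hx (q := q) (by positivity)
    have hir : ‖x - gridPoint R q i‖ ≤ r := by rw [hr, hr₀, mul_div_assoc]; exact hi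
    set z := gridPoint R q i with hz
    refine ⟨truncation hτ r⁻¹ z (waveTaylor m (x - z)), ?_, ?_⟩
    · rw [waveTaylor, map_sum]
      refine Submodule.sum_mem _ fun p _ => ?_
      rw [map_smul]
      exact Submodule.smul_mem _ _ (Submodule.subset_span ⟨(i, p), rfl⟩)
    · set e := evalVec hτ x - truncation hτ r⁻¹ z (waveTaylor m (x - z)) with he
      have hle : ‖e‖ ^ 2 ≤ (K * 2 ^ τ * J) * (r ^ (τ - (d : ℝ) / 2)) ^ 2 := by
        refine (norm_sq_le_of_decay hτ hrpos (v := e) (c := K * (2 * r ^ 2) ^ τ) ?_).trans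
          (le_of_eq ?_)
        · filter_upwards [Lp.coeFn_sub (evalVec hτ x)
            (truncation hτ r⁻¹ z (waveTaylor m (x - z))), (memLp_evalFun hτ x).coeFn_toLp,
            (memLp_truncation hτ r⁻¹ z (waveTaylor m (x - z))).coeFn_toLp] with ξ h1 h2 h3
          have h4 : e ξ = evalFun τ x ξ - (Metric.closedBall 0 r⁻¹).indicator
              (fun ξ => evalFun τ z ξ * waveTaylor m (x - z) ξ) ξ := by
            rw [he, h1, Pi.sub_apply, ← h3, ← h2]; rfl
          rw [h4]
          exact norm_evalFun_sub_truncation_sq_le hτ0 hτm hrpos hir ξ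
        · have h1 : (r ^ (τ - (d : ℝ) / 2)) ^ 2 = (r ^ 2) ^ τ * (r ^ d)⁻¹ := by
            rw [← Real.rpow_mul_natCast hrpos.le, ← Real.rpow_natCast r 2,
              ← Real.rpow_mul hrpos.le, ← Real.rpow_natCast r d, ← Real.rpow_neg hrpos.le,
              ← Real.rpow_add hrpos]
            congr 1; push_cast; ring
          rw [h1, finrank_euclideanSpace_fin, Real.mul_rpow (by norm_num) (by positivity), ← hJ]
          ring
      have hrp : 0 < r ^ (τ - (d : ℝ) / 2) := by positivity
      have hrr : r ^ (τ - (d : ℝ) / 2) =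
          r₀ ^ (τ - (d : ℝ) / 2) * ((2 : ℝ) ^ ((d : ℝ) / 2 - τ)) ^ j := by
        rw [hr, Real.div_rpow hr₀pos.le hqpos.le, div_eq_mul_inv, ← Real.rpow_neg hqpos.le, neg_sub,
          hq]
        push_cast
        rw [← Real.rpow_natCast, ← Real.rpow_mul (by norm_num), mul_comm (j : ℝ),
          Real.rpow_mul (by norm_num), Real.rpow_natCast]
      calc ‖e‖ ≤ √((K * 2 ^ τ * J) * (r ^ (τ - (d : ℝ) / 2)) ^ 2) := Real.le_sqrt_of_sq_le hle
        _ = √(K * 2 ^ τ * J) * r ^ (τ - (d : ℝ) / 2) := by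
            rw [Real.sqrt_mul (by positivity), Real.sqrt_sq hrp.le]
        _ = C * ((2 : ℝ) ^ ((d : ℝ) / 2 - τ)) ^ j := by rw [hrr, hC]; ring
        _ ≤ _ := by gcongr; linarith

end Truncation

/-! ### Fill distances -/

theorem infDist_le_fillDistance {Ω : Type*} [PseudoMetricSpace Ω] [BoundedSpace Ω] {X : Finset Ω}
    (hX : X.Nonempty) (y : Ω) : Metric.infDist y (X : Set Ω) ≤ fillDistance X := by
  obtain ⟨x, hx⟩ := hX
  refine le_ciSup (f := fun y : Ω => Metric.infDist y (X : Set Ω))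
    ⟨Metric.diam (Set.univ : Set Ω), ?_⟩ y
  rintro _ ⟨z, rfl⟩
  exact (Metric.infDist_le_dist_of_mem (by exact_mod_cast hx)).trans
    (Metric.dist_le_diam_of_mem (Bornology.IsBounded.all _) (Set.mem_univ z) (Set.mem_univ x))

theorem exists_closedBall_subset_cone {E : Type*} [NormedAddCommGroup E] [InnerProductSpace ℝ E]
    {θ r : ℝ} (hθ : 0 < θ) (hθ' : θ < Real.pi / 2) (hr : 0 < r) (x : E) {ξ : E} (hξ : ‖ξ‖ = 1) :
    ∃ (p : E) (ρ : ℝ), 0 < ρ ∧ Metric.closedBall p ρ ⊆ cone x ξ θ r := by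
  set c := Real.cos θ with hc
  have hc0 : 0 < c := Real.cos_pos_of_mem_Ioo ⟨by linarith, hθ'⟩
  have hc1 : c < 1 := by
    rw [hc, ← Real.cos_zero]
    exact Real.cos_lt_cos_of_nonneg_of_le_pi_div_two le_rfl hθ'.le hθ
  -- Chosen so that `c (r / 2 + ρ) = r / 2 - ρ`: points of the ball have norm at most `r / 2 + ρ`
  -- and axial component at least `r / 2 - ρ`, relative to the apex.
  set ρ := r / 2 * ((1 - c) / (1 + c)) with hρ
  have hρ0 : 0 < ρ := by
    have : 0 < 1 - c := by linarith
    positivity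
  have hρc : c * (r / 2 + ρ) = r / 2 - ρ := by rw [hρ]; field_simp; ring
  have hρr : ρ < r / 2 := by nlinarith
  refine ⟨x + (r / 2) • ξ, ρ, hρ0, fun z hz => ?_⟩
  set w := z - (x + (r / 2) • ξ) with hw
  have hwρ : ‖w‖ ≤ ρ := by rwa [hw, ← dist_eq_norm]
  set p := (r / 2) • ξ + w with hp
  have hzp : z = x + p := by rw [hp, hw]; abel
  have hξn : ‖(r / 2) • ξ‖ = r / 2 := by
    rw [norm_smul, hξ, mul_one, Real.norm_of_nonneg (by positivity)]
  have hpn : ‖p‖ ≤ r / 2 + ρ := (norm_add_le _ _).trans (by gcongr; exact hξn.le)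
  have hpξ : r / 2 - ρ ≤ ⟪p, ξ⟫_ℝ := by
    rw [hp, inner_add_left, real_inner_smul_left, real_inner_self_eq_norm_sq, hξ]
    have := neg_le_of_abs_le ((abs_real_inner_le_norm w ξ).trans (by rw [hξ, mul_one]))
    linarith
  have hp0 : 0 < ‖p‖ := by
    have := real_inner_le_norm p ξ
    rw [hξ, mul_one] at this
    linarith
  refine ⟨‖p‖⁻¹ • p, ‖p‖, ?_, ?_, hp0.le, by linarith, ?_⟩
  · rw [norm_smul, norm_inv, norm_norm, inv_mul_cancel₀ hp0.ne']
  · rw [real_inner_smul_left, ← hc, inv_mul_eq_div, le_div_iff₀ hp0]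
    nlinarith
  · rw [smul_smul, mul_inv_cancel₀ hp0.ne', one_smul, hzp]

theorem volume_pos_of_interiorConeCondition {d : ℕ} {Ω : Set (EuclideanSpace ℝ (Fin d))}
    (hcone : InteriorConeCondition Ω) (hne : Ω.Nonempty) : 0 < volume Ω := by
  obtain ⟨θ, r, hθ, hθ', hr, h⟩ := hcone
  obtain ⟨x, hx⟩ := hne
  obtain ⟨ξ, hξ, hsub⟩ := h x hx
  obtain ⟨p, ρ, hρ, hball⟩ := exists_closedBall_subset_cone hθ hθ' hr x hξ
  exact (Metric.measure_closedBall_pos volume p hρ).trans_le (measure_mono (hball.trans hsub))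

theorem volume_le_of_fillDistance {d : ℕ} {Ω : Set (EuclideanSpace ℝ (Fin d))}
    (hΩ : IsCompact Ω) {X : Finset Ω} (hX : X.Nonempty) :
    volume Ω ≤ X.card * (ENNReal.ofReal (fillDistance X ^ d) *
      volume (Metric.ball (0 : EuclideanSpace ℝ (Fin d)) 1)) := by
  have : CompactSpace Ω := isCompact_iff_compactSpace.mp hΩ
  have hh : 0 ≤ fillDistance X := Real.iSup_nonneg fun _ => Metric.infDist_nonneg
  have hsub : Ω ⊆ ⋃ x ∈ X, Metric.closedBall (x : EuclideanSpace ℝ (Fin d)) (fillDistance X) := by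
    intro y hy
    obtain ⟨x, hx, hxy⟩ := (X.finite_toSet.isCompact).exists_infDist_eq_dist
      (by exact_mod_cast hX) (⟨y, hy⟩ : Ω)
    refine Set.mem_iUnion₂.mpr ⟨x, by exact_mod_cast hx, ?_⟩
    have := infDist_le_fillDistance hX (⟨y, hy⟩ : Ω)
    rw [hxy] at this
    exact this
  refine (measure_mono hsub).trans ((measure_biUnion_finset_le X _).trans ?_)
  simp only [Measure.addHaar_closedBall _ _ hh, finrank_euclideanSpace_fin, Finset.sum_const,
    nsmul_eq_mul]
  exact le_rfl

/-- The lower bound for fill distances. -/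
theorem exists_le_fillDistance {d : ℕ} (hd : 1 ≤ d) {Ω : Set (EuclideanSpace ℝ (Fin d))}
    (hΩ : IsCompact Ω) (hcone : InteriorConeCondition Ω) :
    ∃ c' : ℝ, 0 < c' ∧ ∀ X : Finset Ω, X.Nonempty →
      c' * (X.card : ℝ) ^ (-1 / (d : ℝ)) ≤ fillDistance X := by
  rcases Ω.eq_empty_or_nonempty with rfl | hne
  · exact ⟨1, one_pos, fun X ⟨x, _⟩ => x.2.elim⟩
  set V := (volume Ω).toReal with hV
  set v := (volume (Metric.ball (0 : EuclideanSpace ℝ (Fin d)) 1)).toReal with hv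
  have hV0 : 0 < V := ENNReal.toReal_pos (volume_pos_of_interiorConeCondition hcone hne).ne'
    hΩ.measure_lt_top.ne
  have hv0 : 0 < v := ENNReal.toReal_pos (Metric.measure_ball_pos volume _ one_pos).ne'
    measure_ball_lt_top.ne
  have hd' : (d : ℝ) ≠ 0 := by positivity
  refine ⟨(V / v) ^ (1 / (d : ℝ)), by positivity, fun X hX => ?_⟩
  have hh : 0 ≤ fillDistance X := Real.iSup_nonneg fun _ => Metric.infDist_nonneg
  have hN : (0 : ℝ) < X.card := by exact_mod_cast hX.card_pos
  have hle : V ≤ X.card * (fillDistance X ^ d * v) := by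
    have := ENNReal.toReal_mono (ENNReal.mul_ne_top (ENNReal.natCast_ne_top _)
      (ENNReal.mul_ne_top ENNReal.ofReal_ne_top measure_ball_lt_top.ne))
      (volume_le_of_fillDistance hΩ hX)
    rwa [ENNReal.toReal_mul, ENNReal.toReal_mul, ENNReal.toReal_natCast,
      ENNReal.toReal_ofReal (by positivity)] at this
  have h2 : V / v * (X.card : ℝ)⁻¹ ≤ fillDistance X ^ d := by
    rw [← div_eq_mul_inv, div_le_iff₀ hN, div_le_iff₀ hv0]
    linarith
  have h3 := Real.rpow_le_rpow (by positivity) h2 (show 0 ≤ 1 / (d : ℝ) by positivity)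
  rw [Real.mul_rpow (by positivity) (by positivity), ← Real.rpow_natCast, ← Real.rpow_mul hh,
    mul_one_div_cancel hd', Real.rpow_one, Real.inv_rpow hN.le, ← Real.rpow_neg hN.le] at h3
  rwa [neg_div]

/-! ### From residuals to fill distances -/

/-- The test function separating `y` from everything at distance at least `infDist y X` vanishes on
`X`; its norm bounds the residual from below. For empty `X` the default `infDist = 0` makes the
claim trivial. -/
theorem exists_infDist_rpow_le {d : ℕ} {τ : ℝ}
    (hτ : (Module.finrank ℝ (EuclideanSpace ℝ (Fin d)) : ℝ) < 2 * τ)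
    {Ω : Set (EuclideanSpace ℝ (Fin d))} {P : ℝ} (hP : 1 ≤ P) :
    ∃ C : ℝ, 0 < C ∧ ∀ (X : Finset Ω) (y : Ω), Metric.infDist y (X : Set Ω) ≤ P →
      Metric.infDist y (X : Set Ω) ^ (τ - (d : ℝ) / 2) ≤
        C * ‖residual (fun x : Ω => evalVec hτ (x : EuclideanSpace ℝ (Fin d))) X y‖ := by
  obtain ⟨C, hC, h⟩ := exists_separating hτ hP
  refine ⟨C, hC, fun X y hy => ?_⟩
  have hs : 0 < τ - (d : ℝ) / 2 := by rw [finrank_euclideanSpace_fin] at hτ; linarith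
  rcases (Metric.infDist_nonneg (x := y) (s := (X : Set Ω))).eq_or_lt with h0 | h0
  · rw [← h0, Real.zero_rpow hs.ne']
    positivity
  obtain ⟨u, hu, huy, hux⟩ := h _ h0 hy y
  have h1 := one_le_norm_residual_mul (fun x : Ω => evalVec hτ (x : EuclideanSpace ℝ (Fin d))) X y
    (fun x hx => hux x (by
      have := Metric.infDist_le_dist_of_mem (x := y) (s := (X : Set Ω)) (by exact_mod_cast hx)
      rwa [dist_comm, Subtype.dist_eq, dist_eq_norm] at this)) huy
  rw [finrank_euclideanSpace_fin, ← neg_sub, Real.rpow_neg h0.le] at hu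
  have h2 := h1.trans (mul_le_mul_of_nonneg_left hu (norm_nonneg _))
  rw [← mul_assoc, ← div_eq_mul_inv, le_div_iff₀ (by positivity), one_mul] at h2
  linarith

/-- The upper bound for the fill distances of stabilized greedy selections. -/
theorem exists_fillDistance_le {d : ℕ} (hd : 1 ≤ d) {Ω : Set (EuclideanSpace ℝ (Fin d))}
    (hΩ : IsCompact Ω) {τ : ℝ} (hτ : (d : ℝ) / 2 < τ) (k : SPDKernel Ω)
    (hk : HasFiniteSmoothness k τ) :
    ∃ c : ℝ, 0 < c ∧ ∀ γ : ℝ, 0 < γ → γ ≤ 1 →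
      ∀ (η : SelectionCriterion Ω) (f : Ω → ℝ) (x : ℕ → Ω) (N : ℕ), 1 ≤ N →
        IsStabilizedGreedy k γ η f x N → fillDistance (firstPoints x N) ≤
          c * γ ^ (-2 / (τ - (d : ℝ) / 2)) * (N : ℝ) ^ (-1 / (d : ℝ)) := by
  have hτ' : (Module.finrank ℝ (EuclideanSpace ℝ (Fin d)) : ℝ) < 2 * τ := by
    rw [finrank_euclideanSpace_fin]; linarith
  set s := τ - (d : ℝ) / 2 with hs
  have hs0 : 0 < s := by linarith
  have hd0 : (d : ℝ) ≠ 0 := by positivity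
  obtain ⟨R, hR1, hR⟩ : ∃ R : ℝ, 1 ≤ R ∧ ∀ x ∈ Ω, ‖x‖ ≤ R := by
    obtain ⟨R, hR⟩ := hΩ.isBounded.exists_norm_le
    exact ⟨max 1 R, le_max_left _ _, fun x hx => (hR x hx).trans (le_max_right _ _)⟩
  obtain ⟨κ, hκ, hκ1, hgreedy⟩ := exists_isWeakGreedy hτ' hk
  obtain ⟨C₀, M, hC₀, hM, hwidth⟩ := exists_widths hd hτ' (R := R) (by linarith)
  set w := fun x : Ω => evalVec hτ' (x : EuclideanSpace ℝ (Fin d)) with hw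
  obtain ⟨C₁, hC₁, hres⟩ := exists_norm_residual_le_of_widths w
    (B := ‖evalVec hτ' (0 : EuclideanSpace ℝ (Fin d))‖) (β := (2 : ℝ) ^ ((d : ℝ) / 2 - τ))
    (by positivity) hC₀ (fun y => (norm_evalVec hτ' _ _).le) hM hd (fun j => by
      obtain ⟨W, hWf, hWd, hW⟩ := hwidth j
      exact ⟨W, hWf, hWd, fun y => hW y (hR y y.2)⟩)
  obtain ⟨C₂, hC₂, hdist⟩ := exists_infDist_rpow_le hτ' (Ω := Ω) (P := 2 * R) (by linarith)
  set A := C₂ * (C₁ / κ ^ 2) with hA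
  have hA0 : 0 < A := by positivity
  set m := (2 * M : ℝ) with hm
  have hm0 : 0 < m := by positivity
  refine ⟨(2 * R + 2 * A ^ (1 / s)) * m ^ (1 / (d : ℝ)), by positivity,
    fun γ hγ hγ1 η f x N hN hx => ?_⟩
  have hN0 : (0 : ℝ) < N := by exact_mod_cast hN
  have hmN : m ^ (1 / (d : ℝ)) * (N : ℝ) ^ (-1 / (d : ℝ)) = (N / m : ℝ) ^ (-1 / (d : ℝ)) := by
    rw [neg_div, Real.rpow_neg hN0.le, Real.rpow_neg (by positivity), Real.div_rpow hN0.le hm0.le]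
    field_simp
  have hγ' : 1 ≤ γ ^ (-2 / s) := Real.one_le_rpow_of_pos_of_le_one_of_nonpos hγ hγ1
    (div_nonpos_of_nonpos_of_nonneg (by norm_num) hs0.le)
  refine Real.iSup_le (fun y => ?_) (by positivity)
  have hyP : Metric.infDist y (firstPoints x N : Set Ω) ≤ 2 * R := by
    refine (Metric.infDist_le_dist_of_mem (y := x 0)
      (by exact_mod_cast mem_firstPoints x hN)).trans ?_
    rw [Subtype.dist_eq, dist_eq_norm]
    refine (norm_sub_le _ _).trans ?_
    linarith [hR y y.2, hR (x 0) (x 0).2]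
  rw [mul_right_comm, mul_assoc (2 * R + 2 * A ^ (1 / s)), hmN]
  -- Below `2 M` points the widths give nothing, but then the diameter bound `2 R` suffices.
  rcases lt_or_ge (N : ℝ) m with hNm | hNm
  · have h1 : 1 ≤ (N / m : ℝ) ^ (-1 / (d : ℝ)) :=
      Real.one_le_rpow_of_pos_of_le_one_of_nonpos (by positivity) ((div_le_one hm0).mpr hNm.le)
        (div_nonpos_of_nonpos_of_nonneg (by norm_num) (by positivity))
    calc Metric.infDist y (firstPoints x N : Set Ω) ≤ 2 * R + 2 * A ^ (1 / s) := by
          have : 0 ≤ 2 * A ^ (1 / s) := by positivity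
          linarith
      _ ≤ (2 * R + 2 * A ^ (1 / s)) * (N / m : ℝ) ^ (-1 / (d : ℝ)) :=
          le_mul_of_one_le_right (by positivity) h1
      _ ≤ _ := le_mul_of_one_le_right (by positivity) hγ'
  · have h2d : (1 : ℝ) < 2 ^ d := one_lt_pow₀ (by norm_num) (by omega)
    -- The finest dyadic level whose `2 M 2 ^ (j d)` points have been selected; rounding down costs
    -- the factor `2` in the constant.
    obtain ⟨j, hj, hj'⟩ := exists_nat_pow_near ((one_le_div hm0).mpr hNm) h2d
    have hjN : 2 * (M * 2 ^ (j * d)) ≤ N := by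
      rw [le_div_iff₀ hm0, ← pow_mul, mul_comm d j] at hj
      have : ((2 * (M * 2 ^ (j * d)) : ℕ) : ℝ) ≤ N := by push_cast; rw [hm] at hj; linarith
      exact_mod_cast this
    have hj2 : ((2 : ℝ) ^ j)⁻¹ ≤ 2 * (N / m : ℝ) ^ (-1 / (d : ℝ)) := by
      have h3 : (N / m : ℝ) ^ (1 / (d : ℝ)) ≤ 2 ^ (j + 1) := by
        refine (Real.rpow_le_rpow (by positivity) hj'.le (by positivity)).trans (le_of_eq ?_)
        rw [← pow_mul, mul_comm, pow_mul, ← Real.rpow_natCast _ d, ← Real.rpow_mul (by positivity),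
          mul_one_div_cancel hd0, Real.rpow_one]
      rw [neg_div, Real.rpow_neg (by positivity), ← div_eq_mul_inv,
        le_div_iff₀ (by positivity), inv_mul_le_iff₀ (by positivity)]
      rwa [← pow_succ]
    have hr := hres (κ * γ) (by positivity) (mul_le_one₀ hκ1 hγ.le hγ1) x N
      (hgreedy γ hγ η f x N hx) j hjN y
    have hD := (hdist _ y hyP).trans (mul_le_mul_of_nonneg_left
      ((norm_residual_anti w (firstPoints_mono x hjN) y).trans hr) hC₂.le)
    have h2j : ((2 : ℝ) ^ ((d : ℝ) / 2 - τ)) ^ j = ((2 : ℝ) ^ j) ^ (-s) := by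
      rw [← Real.rpow_natCast, ← Real.rpow_natCast, ← Real.rpow_mul (by norm_num),
        ← Real.rpow_mul (by norm_num), show (d : ℝ) / 2 - τ = -s by rw [hs]; ring,
        mul_comm (-s) (j : ℝ)]
    -- Written as an `s`-th power so that roots can be taken: `γ⁻²` becomes `γ ^ (-2 / s)`, and `κ`
    -- is absorbed in `A`.
    have hval : C₂ * (C₁ / (κ * γ) ^ 2 * ((2 : ℝ) ^ ((d : ℝ) / 2 - τ)) ^ j) =
        (A ^ (1 / s) * γ ^ (-2 / s) * ((2 : ℝ) ^ j)⁻¹) ^ s := by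
      rw [Real.mul_rpow (by positivity) (by positivity),
        Real.mul_rpow (by positivity) (by positivity), ← Real.rpow_mul hA0.le,
        ← Real.rpow_mul hγ.le, one_div_mul_cancel hs0.ne', Real.rpow_one,
        div_mul_cancel₀ _ hs0.ne', Real.rpow_neg hγ.le, Real.rpow_two,
        Real.inv_rpow (by positivity), ← Real.rpow_neg (by positivity), ← h2j, hA, mul_pow]
      field_simp
    rw [hval, Real.rpow_le_rpow_iff Metric.infDist_nonneg (by positivity) hs0] at hD
    calc Metric.infDist y (firstPoints x N : Set Ω)
        ≤ A ^ (1 / s) * γ ^ (-2 / s) * ((2 : ℝ) ^ j)⁻¹ := hD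
      _ ≤ A ^ (1 / s) * γ ^ (-2 / s) * (2 * (N / m : ℝ) ^ (-1 / (d : ℝ))) := by gcongr
      _ = 2 * A ^ (1 / s) * ((N / m : ℝ) ^ (-1 / (d : ℝ)) * γ ^ (-2 / s)) := by ring
      _ ≤ (2 * R + 2 * A ^ (1 / s)) * ((N / m : ℝ) ^ (-1 / (d : ℝ)) * γ ^ (-2 / s)) := by
          gcongr; linarith
      _ = _ := by ring

end StabilizedGreedy

end
theorem mainTheorem3 (d : ℕ) (hd : 1 ≤ d) (Ω : Set (EuclideanSpace ℝ (Fin d)))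
    (hΩ : IsCompact Ω) (hcone : StabilizedGreedy.InteriorConeCondition Ω)
    (hlip : StabilizedGreedy.HasLipschitzBoundary Ω) :
    (∀ (τ : ℝ), (d : ℝ) / 2 < τ → ∀ k : StabilizedGreedy.SPDKernel Ω,
      StabilizedGreedy.IsTranslationInvariant k → StabilizedGreedy.HasFiniteSmoothness k τ →
      ∃ c : ℝ, 0 < c ∧ ∀ γ : ℝ, 0 < γ → γ ≤ 1 →
        ∀ (η : StabilizedGreedy.SelectionCriterion Ω) (f : Ω → ℝ) (x : ℕ → Ω) (N : ℕ), 1 ≤ N →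
          StabilizedGreedy.IsStabilizedGreedy k γ η f x N →
          StabilizedGreedy.fillDistance (StabilizedGreedy.firstPoints x N) ≤
            c * γ ^ (-2 / (τ - (d : ℝ) / 2)) * (N : ℝ) ^ (-1 / (d : ℝ))) ∧
    (∃ c' : ℝ, 0 < c' ∧ ∀ X : Finset Ω, X.Nonempty →
      c' * (X.card : ℝ) ^ (-1 / (d : ℝ)) ≤ StabilizedGreedy.fillDistance X) := by
  refine ⟨fun τ hτ k _ hk => ?_, StabilizedGreedy.exists_le_fillDistance hd hΩ hcone⟩
  exact StabilizedGreedy.exists_fillDistance_le hd hΩ hτ k hk
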